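/- Consider the standard asynchronous model: $n$ processes, each a deterministic state machine with an input, take a step when they wake up or receive a message, and in a step they change state and send finitely many messages over reliable point-to-point channels; message delays are arbitrary but finite, and at most $f$ processes are faulty. A crash-faulty process may stop taking steps; a malicious one may change state and send messages arbitrarily. The time complexity of an algorithm is the supremum, over all timed executions in which all wakeups of correct processes are at time $0$, the times are nondecreasing nonnegative integers and no process has two events at the same time, of the time at which the last correct process decides, after scaling times so that the maximum delay of the messages between correct processes that are sent up to that point is $1$. An algorithm decides in one round of message exchange if in every execution each correct process has decided as soon as all correct processes are awake and it has received all the messages that they sent to it on wakeup. Let $V$ be a finite totally ordered set with $|V|\ge 2$. The spider graph $G_S(V,R)$ consists of a center $(\bot,0)$ and, for each $v\in V$, a path $(v,1),\dots,(v,R)$ attached to the center at $(v,1)$. In connected consensus for $V$ and $R$ each process has an input in $V$, and the following is required. Termination: every correct process decides on a vertex of $G_S(V,R)$. Validity: every decision lies in the minimal subtree that connects the leaves $(v,R)$, $v$ an input. Agreement: any two decisions are at distance at most one. For crash failures Validity and Agreement refer to all processes, for malicious failures only to the correct ones. Let $R=2$. 1. (Crash failures.) If $n\ge 2$ and $n\le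 4f$, then every algorithm that solves connected consensus with up to $f$ crash failures needs at least two rounds: it does not decide in one round of message exchange, and its time complexity is at least $2$. 2. (Malicious failures.) If $n\ge 2$ and $n\le 9f$, then the same holds for every algorithm that solves connected consensus with up to $f$ malicious failures. 3. If $2f<n\le 4f$, the following crash-tolerant algorithm solves connected consensus with up to $f$ crash failures, has time complexity exactly $2$, and is time-optimal, i.e. no algorithm that solves this problem has smaller time complexity. A process sends its input to all and waits for $n-f$ inputs; its branch is $v$ if all of them equal $v$, and $\bot$ otherwise. It sends its branch to all and waits for $n-f$ branches. If its branch is $\bot$, it decides $(v,1)$ if some received branch is $v\in V$, and $(\bot,0)$ otherwise; if its branch is $w\in V$, it decides $(v,2)$ if all received branches are the same $v\in V$, and $(w,1)$ otherwise. 4. If $5f<n\le 9f$, the following algorithm solves connected consensus with up to $f$ malicious failures, has time complexity exactly $2$, and is time-optimal among all algorithms that solve this problem. It differs from the previous one as follows: a process drops the $f$ smallest and the $f$ largest of the $n-f$ inputs before it determines its branch; the condition for $(v,1)$ is that at least $f+1$ received branches are $v$, and the condition for $(v,2)$ is that at least $n-2f$ are. At most one message of each of the two kinds is taken into account from each sender.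 -/

import Mathlib

open scoped ENNReal

universe u v w

/-! ### Asynchronous message passing with crash or malicious failures -/

/-- The two kinds of failures. -/
inductive FailureMode where
  | crash
  | malicious

/-- An algorithm for `n` processes with inputs in `V` and decisions in `D`: one deterministic
state machine per process. A transition is triggered by a wakeup or by the receipt of a message
`m` from process `q`, and yields a new state and the finite set of messages sent to each process.
A decision, once taken, is never changed. -/
structure Algorithm (n : ℕ) (V : Type u) (D : Type v) where
  State : Type w
  Msg : Type w
  init : Fin n → V → State
  wake : Fin n → State → State × (Fin n → Finset Msg)
  recv : Fin n → State → Fin n → Msg → State × (Fin n → Finset Msg)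
  decision : Fin n → State → Option D
  decision_wake : ∀ p s d, decision p s = some d → decision p (wake p s).1 = some d
  decision_recv : ∀ p s q m d, decision p s = some d → decision p (recv p s q m).1 = some d

/-- Events: `wake p` is a wakeup of process `p`; `recv p q j m` is the receipt, by process `p`, of
the message `m` that process `q` sent to `p` in the `j`-th event of the execution. -/
inductive Event (n : ℕ) (M : Type w) where
  | wake (p : Fin n)
  | recv (p q : Fin n) (j : ℕ) (m : M)

/-- The process that takes the step. -/
def Event.proc {n : ℕ} {M : Type w} : Event n M → Fin n
  | .wake p => p
  | .recv p _ _ _ => p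

namespace Algorithm

variable {n : ℕ} {V : Type u} {D : Type v}

/-- The transition of the algorithm for an event, applied to the current state of the process
that takes the step. -/
def transition (A : Algorithm.{u, v, w} n V D) (e : Event n A.Msg) (s : A.State) :
    A.State × (Fin n → Finset A.Msg) :=
  match e with
  | .wake p => A.wake p s
  | .recv p q _ m => A.recv p s q m

/-- A (complete) execution of `A` with at most `f` faulty processes. `state k` is the vector of
process states before the `k`-th event and `sent k q` is the set of messages sent to `q` in the
`k`-th event. An index `k` with `event k = none` is an empty slot in which nothing happens, so
that finite executions are included. Messages sent in different events are different messages. -/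
structure Execution (A : Algorithm.{u, v, w} n V D) (mode : FailureMode) (f : ℕ) where
  input : Fin n → V
  faulty : Finset (Fin n)
  card_faulty : faulty.card ≤ f
  event : ℕ → Option (Event n A.Msg)
  state : ℕ → Fin n → A.State
  sent : ℕ → Fin n → Finset A.Msg
  state_zero : ∀ p, state 0 p = A.init p (input p)
  /-- The first event of every process is a wakeup. -/
  wake_first : ∀ k p q j m, event k = some (.recv p q j m) → ∃ i < k, event i = some (.wake p)
  /-- A correct process wakes up exactly once. -/
  wake_correct : ∀ p, p ∉ faulty → ∃! k, event k = some (.wake p)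
  /-- A crash-faulty process wakes up at most once. -/
  wake_crash : mode = .crash →
    ∀ p i k, event i = some (.wake p) → event k = some (.wake p) → i = k
  /-- A received message was sent before to its recipient by its sender. -/
  recv_sent : ∀ k p q j m, event k = some (.recv p q j m) →
    j < k ∧ (∃ e, event j = some e ∧ e.proc = q) ∧ m ∈ sent j p
  /-- A message is received at most once. -/
  recv_once : ∀ i k p q j m, event i = some (.recv p q j m) → event k = some (.recv p q j m) →
    i = k
  /-- Every message sent to a correct process is eventually received. -/
  recv_eventually : ∀ j p m, p ∉ faulty → m ∈ sent j p → ∃ k q, event k = some (.recv p q j m)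
  /-- Nothing happens in an empty slot. -/
  step_none : ∀ k, event k = none → state (k + 1) = state k ∧ ∀ q, sent k q = ∅
  /-- A step changes only the state of the process that takes it. -/
  step_other : ∀ k e, event k = some e → ∀ q, q ≠ e.proc → state (k + 1) q = state k q
  /-- Every process that is not malicious follows its transition function. A malicious process
  may enter any state and send any messages. -/
  step_honest : ∀ k e, event k = some e → (mode = .crash ∨ e.proc ∉ faulty) →
    (state (k + 1) e.proc, sent k) = A.transition e (state k e.proc)

namespace Execution

variable {A : Algorithm.{u, v, w} n V D} {mode : FailureMode} {f : ℕ}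

/-- The processes that are bound by the safety requirements: all processes in the case of crash
failures, the correct ones in the case of malicious failures. -/
def Bound (E : A.Execution mode f) (p : Fin n) : Prop :=
  mode = .crash ∨ p ∉ E.faulty

/-- Process `p` decides `d` in the execution. -/
def Decides (E : A.Execution mode f) (p : Fin n) (d : D) : Prop :=
  ∃ k, A.decision p (E.state k p) = some d

/-- Before the `k`-th event all correct processes have decided. -/
def AllDecided (E : A.Execution mode f) (k : ℕ) : Prop :=
  ∀ p, p ∉ E.faulty → ∃ d, A.decision p (E.state k p) = some d

/-- `time` makes the execution a timed execution: times are nondecreasing, no two events of the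
same process have the same time, and the first wakeup of every process is at time 0. -/
structure IsTiming (E : A.Execution mode f) (time : ℕ → ℕ) : Prop where
  mono : Monotone time
  strict : ∀ i k e e', i < k → E.event i = some e → E.event k = some e' → e.proc = e'.proc →
    time i < time k
  wake_zero : ∀ k p, E.event k = some (.wake p) → (∀ i < k, E.event i ≠ some (.wake p)) →
    time k = 0

/-- The delays of the messages between correct processes that are sent in the events up to and
including the `N`-th. -/
def delays (E : A.Execution mode f) (time : ℕ → ℕ) (N : ℕ) : Set ℕ :=
  {δ | ∃ k p q j m, E.event k = some (.recv p q j m) ∧ p ∉ E.faulty ∧ q ∉ E.faulty ∧ j ≤ N ∧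
    δ = time k - time j}

end Execution

/-- Time complexity: the supremum, over all timed executions, of the time of the event `N` by
which the last correct process decides, after scaling the times so that the maximum delay `δ` of
the messages between correct processes sent until then becomes 1. (The latest wakeup of a correct
process, from which time is counted, is at time 0.) -/
noncomputable def timeComplexity (A : Algorithm.{u, v, w} n V D) (mode : FailureMode) (f : ℕ) :
    ℝ≥0∞ :=
  sSup {t | ∃ (E : A.Execution mode f) (time : ℕ → ℕ) (N δ : ℕ), E.IsTiming time ∧
    IsLeast {k | E.AllDecided k} (N + 1) ∧ IsGreatest (E.delays time N) δ ∧ 0 < δ ∧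
    t = (time N : ℝ≥0∞) / (δ : ℝ≥0∞)}

/-- One round of message exchange suffices for the algorithm: in every execution, as soon as all
correct processes have woken up and a correct process `p` has received all the messages that they
sent to it when they woke up, `p` has decided. -/
def DecidesInOneRound (A : Algorithm.{u, v, w} n V D) (mode : FailureMode) (f : ℕ) : Prop :=
  ∀ (E : A.Execution mode f) (p : Fin n) (k : ℕ), p ∉ E.faulty →
    (∀ q, q ∉ E.faulty → ∃ j < k, E.event j = some (.wake q) ∧
      ∀ m ∈ E.sent j p, ∃ i < k, E.event i = some (.recv p q j m)) →
    ∃ d, A.decision p (E.state k p) = some d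

end Algorithm

/-! ### Connected consensus -/

/-- The vertices of the spider graph: `center` is `(⊥, 0)` and `branch v i` is `(v, i + 1)`. -/
inductive SpiderVertex (V : Type u) (R : ℕ) where
  | center
  | branch (v : V) (i : Fin R)

/-- The spider graph: a path with `R` vertices for each `v`, attached to the center. -/
def spiderGraph (V : Type u) (R : ℕ) : SimpleGraph (SpiderVertex V R) :=
  SimpleGraph.fromRel fun x y =>
    match x, y with
    | .center, .branch _ i => i.val = 0
    | .branch v i, .branch w j => v = w ∧ i.val + 1 = j.val
    | _, _ => False

/-- The leaves `(v, R)` with `v ∈ I`. -/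
def spiderLeaves {V : Type u} (R : ℕ) (I : Set V) : Set (SpiderVertex V R) :=
  {x | ∃ v ∈ I, ∃ i : Fin R, i.val + 1 = R ∧ x = .branch v i}

/-- The vertex set of the minimal subtree of the spider graph that connects the leaves `(v, R)`,
`v ∈ I`: the intersection of all connected vertex sets that contain these leaves. -/
def spiderSubtree {V : Type u} (R : ℕ) (I : Set V) : Set (SpiderVertex V R) :=
  {x | ∀ S : Set (SpiderVertex V R), spiderLeaves R I ⊆ S →
    ((spiderGraph V R).induce S).Preconnected → x ∈ S}

/-- The algorithm solves connected consensus for `V` and `R` with up to `f` failures. -/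
structure Algorithm.SolvesConnectedConsensus {n : ℕ} {V : Type u} {R : ℕ}
    (A : Algorithm.{u, u, w} n V (SpiderVertex V R)) (mode : FailureMode) (f : ℕ) : Prop where
  termination : ∀ (E : A.Execution mode f) (p : Fin n), p ∉ E.faulty → ∃ d, E.Decides p d
  validity : ∀ (E : A.Execution mode f) (p : Fin n) (d : SpiderVertex V R), E.Bound p →
    E.Decides p d → d ∈ spiderSubtree R (E.input '' {q | E.Bound q})
  agreement : ∀ (E : A.Execution mode f) (p q : Fin n) (d d' : SpiderVertex V R), E.Bound p →
    E.Bound q → E.Decides p d → E.Decides q d' → (spiderGraph V R).edist d d' ≤ 1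

/-! ### The two-round algorithms for `R = 2` -/

namespace TwoRound

/-- The messages `⟨input, v⟩` and `⟨branch, b⟩`, where `none` stands for `⊥`. -/
inductive Msg (V : Type u) where
  | input (v : V)
  | branch (b : Option V)

/-- Local state: the input, the senders and contents of the input and branch messages received so
far in the order of their receipt, the variable `branch` (`none` until it is assigned) and the
decision. -/
structure State (n : ℕ) (V : Type u) where
  input : V
  inputs : List (Fin n × V)
  branches : List (Fin n × Option V)
  branch : Option (Option V)
  decision : Option (SpiderVertex V 2)

/-- Append a message, unless one of the same kind from the same sender was received before. -/
def record {n : ℕ} {X : Type u} (l : List (Fin n × X)) (q : Fin n) (x : X) : List (Fin n × X) :=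
  if q ∈ l.map Prod.fst then l else l ++ [(q, x)]

variable {n : ℕ} {V : Type u} [LinearOrder V]

/-- Drop the `trim` smallest and the `trim` largest of the received values `l`; the branch is `v`
if all remaining values are `v`, and `⊥` otherwise. -/
def chooseBranch (trim : ℕ) (l : List V) : Option V :=
  match ((l.insertionSort (· ≤ ·)).drop trim).rdrop trim with
  | [] => none
  | v :: t => if ∀ x ∈ t, x = v then some v else none

/-- The decision of a process with branch `b` that received the branch values `B`. If `b = ⊥`, it
is `(v, 1)` if some `v` occurs at least `low` times in `B`, and `(⊥, 0)` otherwise; if `b = w`, it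
is `(v, 2)` if some `v` occurs at least `high` times in `B`, and `(w, 1)` otherwise. -/
def chooseVertex (low high : ℕ) (b : Option V) (B : List (Option V)) : SpiderVertex V 2 :=
  match b with
  | none =>
    match B.reduceOption.find? (fun v => low ≤ B.count (some v)) with
    | some v => .branch v 0
    | none => .center
  | some w =>
    match B.reduceOption.find? (fun v => high ≤ B.count (some v)) with
    | some v => .branch v 1
    | none => .branch w 0

/-- Store a received message. -/
def store (s : State n V) (q : Fin n) (m : Msg V) : State n V :=
  match m with
  | .input v => { s with inputs := record s.inputs q v }
  | .branch b => { s with branches := record s.branches q b }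

/-- If `branch` is not yet assigned and `quorum` input messages have been received, assign
`branch` and send it to all. -/
def endRoundOne (quorum trim : ℕ) (s : State n V) : State n V × (Fin n → Finset (Msg V)) :=
  if s.branch = none ∧ quorum ≤ s.inputs.length then
    let b := chooseBranch trim ((s.inputs.take quorum).map Prod.snd)
    ({ s with branch := some b }, fun _ => {Msg.branch b})
  else (s, fun _ => ∅)

/-- If `branch` is assigned, no decision has been taken and `quorum` branch messages have been
received, decide. -/
def endRoundTwo (quorum low high : ℕ) (s : State n V) : State n V :=
  match s.branch, s.decision with
  | some b, none =>
    if quorum ≤ s.branches.length then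
      let d := chooseVertex low high b ((s.branches.take quorum).map Prod.snd)
      { s with decision := some d }
    else s
  | _, _ => s

/-- Send the input to all and wait for `quorum` input messages; assign `branch`, send it to all and
wait for `quorum` branch messages; decide. -/
def algorithm (n : ℕ) (V : Type u) [LinearOrder V] (quorum trim low high : ℕ) :
    Algorithm.{u, u, u} n V (SpiderVertex V 2) where
  State := State n V
  Msg := Msg V
  init _ v := { input := v, inputs := [], branches := [], branch := none, decision := none }
  wake _ s := (s, fun _ => {Msg.input s.input})
  recv _ s q m :=
    let r := endRoundOne quorum trim (store s q m)
    (endRoundTwo quorum low high r.1, r.2)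
  decision _ s := s.decision
  decision_wake _ _ _ h := h
  decision_recv p s q m d h := by
    have h1 : (endRoundOne quorum trim (store s q m)).1.decision = some d := by
      unfold endRoundOne store
      cases m <;> dsimp only <;> split_ifs <;> exact h
    show (endRoundTwo quorum low high (endRoundOne quorum trim (store s q m)).1).decision = some d
    generalize (endRoundOne quorum trim (store s q m)).1 = t at h1
    unfold endRoundTwo
    split
    · simp_all
    · exact h1

end TwoRound

/-- The algorithm for `n > 2f` and crash failures, `R = 2`. Since exactly `n - f` branch messages
are used, all of them are `v` if and only if at least `n - f` of them are. -/
def crashAlgorithm (n f : ℕ) (V : Type u) [LinearOrder V] :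
    Algorithm.{u, u, u} n V (SpiderVertex V 2) :=
  TwoRound.algorithm n V (n - f) 0 1 (n - f)

/-- The algorithm for `n > 5f` and malicious failures, `R = 2`. -/
def maliciousAlgorithm (n f : ℕ) (V : Type u) [LinearOrder V] :
    Algorithm.{u, u, u} n V (SpiderVertex V 2) :=
  TwoRound.algorithm n V (n - f) f (f + 1) (n - 2 * f)

/-! ### Executions from scripts -/

/-! The lower bounds rest on a chain of indistinguishable views. Up to `f` processes may never wake
up. So an algorithm that decides in one round, or has time complexity below 2, must let a process
decide on its `view` alone: its wakeup and the first messages of the processes outside a set of at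
most `f` (`exists_decision_view`). In the timed case, first messages and later ones can both be
given delays close to `L`, and a later decision would cost a ratio that tends to 2 as `L` grows
(`Script.two_le_timeComplexity`). For crash failures, split the processes into four blocks of size
at most `f`. In `I r` the blocks before `r` hold `w` and the others `v`. A view of `I r` that lacks
block `r` is also a view of `I (r + 1)`. Hence views `r` and `r + 1` can occur at two processes in
one execution (`exists_execution_of_views`), and their decisions are at distance at most one. View 0
fits the constant input `v` and view 3 the constant input `w`, so validity forces two different
leaves. These are at distance 4, and three links cannot join them. For malicious failures, a
two-faced faulty block bridges one further change of input in each link and at either end. Four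
views at `r = 1, 3, 5, 7` then cover nine blocks. For the upper bounds, both algorithms are
instances (`b = 0` and `b = f`) of one algorithm with trim `b` and thresholds `b + 1` and `n - f -
b`. It is correct if `2 * f + 3 * b < n`, where at most `b` processes escape the safety
requirements. Counting senders shows that all non-`⊥` branches of bound processes agree
(`branch_unique`), that such a branch is the input of a bound process (`exists_input_of_branch`),
and that `n - f - b` copies of a branch in one sample force `b + 1` copies in every other
(`low_le_count`). The last fact keeps a leaf and the center from being decided together. -/

theorem List.IsPrefix.getElem?_eq_some_of {α : Type u} {l l' : List α} (h : l <+: l') {i : ℕ}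
    {x : α} (hx : l[i]? = some x) : l'[i]? = some x := by
  obtain ⟨t, rfl⟩ := h
  rw [List.getElem?_append_left (List.getElem?_eq_some_iff.1 hx).1, hx]

namespace Algorithm

variable {n : ℕ} {V : Type u} {D : Type v}

/-- A description of an execution: the processes in `awake` wake up and send the messages `first`
(faulty ones never take another step), these messages are received in the given order, and all
later messages are received in the order in which they are sent. -/
structure Script (A : Algorithm.{u, v, w} n V D) where
  input : Fin n → V
  faulty : Finset (Fin n)
  awake : Finset (Fin n)
  correct_awake : ∀ p, p ∉ faulty → p ∈ awake
  first : Fin n → Fin n → Finset A.Msg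
  first_correct : ∀ p, p ∉ faulty → first p = (A.wake p (A.init p (input p))).2
  order : List (Fin n × Fin n × A.Msg)
  order_nodup : order.Nodup
  mem_order : ∀ p q m, (p, q, m) ∈ order ↔ p ∉ faulty ∧ q ∈ awake ∧ m ∈ first q p

namespace Script

variable {A : Algorithm.{u, v, w} n V D} (S : A.Script)

/-- The wakeups and the receipts of the first messages. -/
def start : List (Option (Event n A.Msg)) :=
  (List.finRange n).map (fun p => if p ∈ S.awake then some (.wake p) else none) ++
    S.order.map (fun x => some (.recv x.1 x.2.1 x.2.1 x.2.2))

/-- The effect of an event on the process that takes the step. -/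
def step (e : Event n A.Msg) (s : A.State) : A.State × (Fin n → Finset A.Msg) :=
  match e with
  | .wake p => (if p ∈ S.faulty then s else (A.wake p s).1, S.first p)
  | .recv p q _ m => A.recv p s q m

/-- The receipts that are scheduled because of the `k`-th event. -/
noncomputable def news (k : ℕ) (e : Event n A.Msg) (out : Fin n → Finset A.Msg) :
    List (Option (Event n A.Msg)) :=
  match e with
  | .wake _ => []
  | .recv p _ _ _ =>
    (S.faultyᶜ).toList.flatMap fun r => (out r).toList.map fun m => some (.recv r p k m)

/-- The process states before the `k`-th event, and all events scheduled by then. -/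
noncomputable def run : ℕ → (Fin n → A.State) × List (Option (Event n A.Msg))
  | 0 => (fun p => A.init p (S.input p), S.start)
  | k + 1 =>
    match (run k).2[k]?.join with
    | none => run k
    | some e =>
      (Function.update (run k).1 e.proc (S.step e ((run k).1 e.proc)).1,
        (run k).2 ++ S.news k e (S.step e ((run k).1 e.proc)).2)

noncomputable def event (k : ℕ) : Option (Event n A.Msg) := (S.run k).2[k]?.join

noncomputable def sent (k : ℕ) : Fin n → Finset A.Msg :=
  match S.event k with
  | none => fun _ => ∅
  | some e => (S.step e ((S.run k).1 e.proc)).2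

theorem run_succ_none {k : ℕ} (h : S.event k = none) : S.run (k + 1) = S.run k := by
  rw [run]; unfold event at h; rw [h]

theorem run_succ_some {k : ℕ} {e : Event n A.Msg} (h : S.event k = some e) :
    S.run (k + 1) = (Function.update (S.run k).1 e.proc (S.step e ((S.run k).1 e.proc)).1,
        (S.run k).2 ++ S.news k e (S.step e ((S.run k).1 e.proc)).2) := by
  rw [run]; unfold event at h; rw [h]

theorem sent_none {k : ℕ} (h : S.event k = none) (q : Fin n) : S.sent k q = ∅ := by
  unfold sent; rw [h]

theorem sent_some {k : ℕ} {e : Event n A.Msg} (h : S.event k = some e) :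
    S.sent k = (S.step e ((S.run k).1 e.proc)).2 := by
  unfold sent; rw [h]

theorem run_prefix_succ (k : ℕ) : (S.run k).2 <+: (S.run (k + 1)).2 := by
  cases h : S.event k with
  | none => rw [S.run_succ_none h]
  | some e => rw [S.run_succ_some h]; exact List.prefix_append _ _

theorem run_prefix {i k : ℕ} (h : i ≤ k) : (S.run i).2 <+: (S.run k).2 := by
  induction k, h using Nat.le_induction with
  | base => exact List.prefix_rfl
  | succ k _ ih => exact ih.trans (S.run_prefix_succ k)

/-- Only a scheduled event can schedule further ones, so nothing happens any more once the current
position is past the end of the list. -/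
theorem run_stuck {i : ℕ} (h : (S.run i).2.length ≤ i) {k : ℕ} (hk : i ≤ k) :
    S.run k = S.run i := by
  induction k, hk using Nat.le_induction with
  | base => rfl
  | succ k hk ih =>
    rw [S.run_succ_none, ih]
    unfold event
    rw [ih, List.getElem?_eq_none (h.trans hk)]
    rfl

/-- The list only grows at its end, so entries keep their positions. If position `i` is still beyond
the end at step `i`, then `run_stuck` rules out that it is filled later. -/
theorem event_of_getElem? {i k : ℕ} {x : Option (Event n A.Msg)} (h : (S.run k).2[i]? = some x) :
    S.event i = x := by
  have key : (S.run i).2[i]? = some x := by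
    rcases le_total k i with hk | hk
    · exact List.IsPrefix.getElem?_eq_some_of (S.run_prefix hk) h
    · by_cases hi : (S.run i).2.length ≤ i
      · rw [S.run_stuck hi hk] at h; exact h
      · rw [← h]
        obtain ⟨t, ht⟩ := S.run_prefix hk
        rw [← ht, List.getElem?_append_left (by omega)]
  unfold event; rw [key]; rfl

theorem getElem?_of_event {i : ℕ} {e : Event n A.Msg} (h : S.event i = some e) :
    (S.run i).2[i]? = some (some e) := by
  unfold event at h
  rcases hx : (S.run i).2[i]? with _ | x
  · rw [hx] at h; cases h
  · rw [hx] at h; exact congrArg some h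

theorem mem_of_event {i : ℕ} {e : Event n A.Msg} (h : S.event i = some e) :
    some e ∈ (S.run i).2 :=
  List.mem_of_getElem? (S.getElem?_of_event h)

theorem event_of_mem {k : ℕ} {x : Option (Event n A.Msg)} (h : x ∈ (S.run k).2) :
    ∃ i < (S.run k).2.length, S.event i = x := by
  obtain ⟨i, hi, rfl⟩ := List.getElem_of_mem h
  exact ⟨i, hi, S.event_of_getElem? (List.getElem?_eq_getElem hi)⟩

theorem event_start {i : ℕ} {x : Option (Event n A.Msg)} (h : S.start[i]? = some x) :
    S.event i = x :=
  S.event_of_getElem? (k := 0) h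

theorem event_lt (p : Fin n) :
    S.event p = if p ∈ S.awake then some (.wake p) else none := by
  apply S.event_start
  unfold start
  rw [List.getElem?_append_left (by simp)]
  simp

theorem event_first {i : ℕ} {x : Fin n × Fin n × A.Msg} (h : S.order[i]? = some x) :
    S.event (n + i) = some (.recv x.1 x.2.1 x.2.1 x.2.2) := by
  apply S.event_start
  unfold start
  rw [List.getElem?_append_right (by simp)]
  simp [h]

theorem event_recv_ge {k : ℕ} {p q : Fin n} {j : ℕ} {m : A.Msg}
    (h : S.event k = some (.recv p q j m)) : n ≤ k := by
  by_contra hk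
  have := S.event_lt ⟨k, by omega⟩
  simp only at this
  rw [h] at this
  split_ifs at this; simp at this

theorem mem_news {k : ℕ} {e : Event n A.Msg} {out : Fin n → Finset A.Msg}
    {x : Option (Event n A.Msg)} : x ∈ S.news k e out ↔
      (∃ p q j m, e = .recv p q j m) ∧
        ∃ r, r ∉ S.faulty ∧ ∃ m ∈ out r, x = some (.recv r e.proc k m) := by
  cases e with
  | wake p => simp [news]
  | recv p q j m => simp [news, Event.proc, eq_comm]

/-- What is known about the events that are scheduled before the `k`-th step. -/
def Justified (k : ℕ) : Event n A.Msg → Prop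
  | .wake p => p ∈ S.awake
  | .recv p q j m => p ∉ S.faulty ∧
      ((j = q ∧ q ∈ S.awake ∧ m ∈ S.first q p) ∨
        (n ≤ j ∧ j < k ∧ (∃ e', S.event j = some e' ∧ e'.proc = q) ∧ m ∈ S.sent j p))

theorem Justified.succ {k : ℕ} {e : Event n A.Msg} (h : S.Justified k e) :
    S.Justified (k + 1) e := by
  cases e with
  | wake p => exact h
  | recv p q j m =>
    obtain ⟨h1, h2 | ⟨h2, h3, h4⟩⟩ := h
    · exact ⟨h1, Or.inl h2⟩
    · exact ⟨h1, Or.inr ⟨h2, by omega, h4⟩⟩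

theorem mem_run {k : ℕ} {e : Event n A.Msg} (h : some e ∈ (S.run k).2) : S.Justified k e := by
  induction k with
  | zero =>
    simp only [run, start, List.mem_append, List.mem_map] at h
    rcases h with ⟨p, -, hp⟩ | ⟨⟨p, q, m⟩, hx, hp⟩
    · split_ifs at hp with hw
      cases hp
      exact hw
    · cases hp
      obtain ⟨h1, h2, h3⟩ := (S.mem_order p q m).1 hx
      exact ⟨h1, Or.inl ⟨rfl, h2, h3⟩⟩
  | succ k ih =>
    cases he : S.event k with
    | none => rw [S.run_succ_none he] at h; exact (ih h).succ
    | some e' =>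
      rw [S.run_succ_some he] at h
      rcases List.mem_append.1 h with h | h
      · exact (ih h).succ
      · obtain ⟨⟨p', q', j', m', rfl⟩, r, hr, m, hm, hx⟩ := S.mem_news.1 h
        cases hx
        refine ⟨hr, Or.inr ⟨S.event_recv_ge he, by omega, ⟨_, he, rfl⟩, ?_⟩⟩
        rw [S.sent_some he]
        exact hm

/-- Receipts scheduled in step `k` carry the index `k` of the sending event, while by `Justified`
all receipts scheduled before carry a smaller index. Only empty slots can repeat. -/
theorem run_pairwise (k : ℕ) : (S.run k).2.Pairwise (fun x y => x ≠ none → x ≠ y) := by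
  induction k with
  | zero =>
    simp only [run, start]
    rw [List.pairwise_append]
    refine ⟨?_, ?_, ?_⟩
    · rw [List.pairwise_map]
      refine (List.nodup_finRange n).imp ?_
      intro a b hab h
      split_ifs at h ⊢ <;> simp_all
    · rw [List.pairwise_map]
      refine S.order_nodup.imp ?_
      rintro ⟨a, b, c⟩ ⟨a', b', c'⟩ hab - h
      simp at h
      simp_all
    · intro x hx y hy _
      simp only [List.mem_map] at hx hy
      obtain ⟨p, -, rfl⟩ := hx
      obtain ⟨z, -, rfl⟩ := hy
      split_ifs <;> simp
  | succ k ih =>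
    cases he : S.event k with
    | none => rw [S.run_succ_none he]; exact ih
    | some e =>
      rw [S.run_succ_some he, List.pairwise_append]
      refine ⟨ih, ?_, ?_⟩
      · cases e with
        | wake p => simp [news]
        | recv p q j m =>
          rw [news, List.pairwise_flatMap]
          refine ⟨fun r _ => ?_, ?_⟩
          · rw [List.pairwise_map]
            refine (Finset.nodup_toList _).imp ?_
            intro a b hab _ h
            simp at h
            exact hab h
          · refine (Finset.nodup_toList _).imp ?_
            intro a b hab x hx y hy _ hxy
            simp only [List.mem_map] at hx hy
            obtain ⟨_, _, rfl⟩ := hx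
            obtain ⟨_, _, rfl⟩ := hy
            simp at hxy
            exact hab hxy.1
      · rintro x hx y hy - rfl
        obtain ⟨⟨p', q', j', m', rfl⟩, r, hr, m, hm, rfl⟩ := S.mem_news.1 hy
        have hk := S.event_recv_ge he
        obtain ⟨_, ⟨h1, _⟩ | ⟨_, h1, _⟩⟩ := S.mem_run hx
        · have := p'.isLt
          simp only [Event.proc] at h1
          omega
        · omega

theorem event_inj {i k : ℕ} {e : Event n A.Msg} (hi : S.event i = some e)
    (hk : S.event k = some e) : i = k := by
  by_contra hne
  wlog h : i < k generalizing i k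
  · exact this hk hi (Ne.symm hne) (by omega)
  have h1 := List.IsPrefix.getElem?_eq_some_of (S.run_prefix h.le) (S.getElem?_of_event hi)
  have h2 := S.getElem?_of_event hk
  obtain ⟨b1, h1⟩ := List.getElem?_eq_some_iff.1 h1
  obtain ⟨b2, h2⟩ := List.getElem?_eq_some_iff.1 h2
  have := List.pairwise_iff_getElem.1 (S.run_pairwise k) i k b1 b2 h
  rw [h1, h2] at this
  exact absurd rfl (this (by simp))

theorem event_wake {k : ℕ} {p : Fin n} (h : S.event k = some (.wake p)) :
    k = p ∧ p ∈ S.awake := by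
  have hp : p ∈ S.awake := S.mem_run (S.mem_of_event h)
  refine ⟨S.event_inj h ?_, hp⟩
  rw [S.event_lt, if_pos hp]

theorem state_of_event {k : ℕ} {e : Event n A.Msg} (h : S.event k = some e) :
    (S.run (k + 1)).1 = Function.update (S.run k).1 e.proc (S.step e ((S.run k).1 e.proc)).1 := by
  rw [S.run_succ_some h]

theorem state_before_wake {k : ℕ} {p : Fin n} (h : k ≤ p) :
    (S.run k).1 p = A.init p (S.input p) := by
  induction k with
  | zero => rfl
  | succ k ih =>
    have hk : k < n := by omega
    have := S.event_lt ⟨k, hk⟩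
    simp only at this
    split_ifs at this with ha
    · rw [S.state_of_event this, Function.update_of_ne, ih (by omega)]
      rintro rfl
      simp [Event.proc] at h
    · rw [S.run_succ_none this, ih (by omega)]

theorem sent_lt {p : Fin n} (h : p ∈ S.awake) : S.sent p = S.first p := by
  have := S.event_lt p
  rw [if_pos h] at this
  rw [S.sent_some this]
  rfl

theorem mem_run_of_sent {j : ℕ} {e : Event n A.Msg} {p : Fin n} {m : A.Msg}
    (he : S.event j = some e) (hp : p ∉ S.faulty) (hm : m ∈ S.sent j p) :
    some (.recv p e.proc j m) ∈ (S.run (j + 1)).2 := by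
  cases e with
  | wake q =>
    obtain ⟨rfl, hq⟩ := S.event_wake he
    rw [S.sent_lt hq] at hm
    refine (S.run_prefix (Nat.zero_le _)).subset ?_
    simp only [run, start]
    refine List.mem_append_right _ (List.mem_map.2 ⟨(p, q, m), (S.mem_order _ _ _).2 ⟨hp, hq, hm⟩, rfl⟩)
  | recv q q' j' m' =>
    rw [S.run_succ_some he]
    rw [S.sent_some he] at hm
    exact List.mem_append_right _ (S.mem_news.2 ⟨⟨_, _, _, _, rfl⟩, p, hp, m, hm, rfl⟩)

/-- The execution that follows the script. -/
noncomputable def execution (mode : FailureMode) (f : ℕ) (hf : S.faulty.card ≤ f)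
    (hcrash : mode = .crash → ∀ p ∈ S.awake, p ∉ S.faulty) : A.Execution mode f where
  input := S.input
  faulty := S.faulty
  card_faulty := hf
  event := S.event
  state k := (S.run k).1
  sent := S.sent
  state_zero _ := rfl
  wake_first k p q j m h := by
    have h1 := (S.mem_run (S.mem_of_event h)).1
    refine ⟨p, p.isLt.trans_le (S.event_recv_ge h), ?_⟩
    rw [S.event_lt, if_pos (S.correct_awake p h1)]
  wake_correct p hp := by
    refine ⟨p, ?_, fun k hk => (S.event_wake hk).1⟩
    simp only
    rw [S.event_lt, if_pos (S.correct_awake p hp)]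
  wake_crash _ p i k hi hk := S.event_inj hi hk
  recv_sent k p q j m h := by
    obtain ⟨h1, ⟨rfl, h2, h3⟩ | ⟨h2, h3, h4, h5⟩⟩ := S.mem_run (S.mem_of_event h)
    · refine ⟨q.isLt.trans_le (S.event_recv_ge h), ⟨.wake q, ?_, rfl⟩, ?_⟩
      · rw [S.event_lt, if_pos h2]
      · rwa [S.sent_lt h2]
    · exact ⟨h3, h4, h5⟩
  recv_once i k p q j m hi hk := S.event_inj hi hk
  recv_eventually j p m hp hm := by
    cases he : S.event j with
    | none => simp [S.sent_none he] at hm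
    | some e =>
      obtain ⟨i, -, hi⟩ := S.event_of_mem (S.mem_run_of_sent he hp hm)
      exact ⟨i, _, hi⟩
  step_none k h := ⟨by rw [S.run_succ_none h], S.sent_none h⟩
  step_other k e h q hq := by rw [S.state_of_event h, Function.update_of_ne hq]
  step_honest k e h hm := by
    rw [S.state_of_event h, Function.update_self, S.sent_some h]
    cases e with
    | wake p =>
      obtain ⟨rfl, hp⟩ := S.event_wake h
      -- A wakeup that has to be honest is never that of a faulty process: with crash failures these
      -- stay asleep.
      have hpf : p ∉ S.faulty := hm.elim (fun hc => hcrash hc p hp) id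
      simp only [step, transition, Event.proc, if_neg hpf, S.state_before_wake le_rfl,
        S.first_correct p hpf]
    | recv p q j m => rfl

theorem state_awake {p : Fin n} (hp : p ∉ S.faulty) {k : ℕ} (hk : p < k) (hkn : k ≤ n) :
    (S.run k).1 p = (A.wake p (A.init p (S.input p))).1 := by
  induction k, hk using Nat.le_induction with
  | base =>
    have := S.event_lt p
    rw [if_pos (S.correct_awake p hp)] at this
    rw [Nat.succ_eq_add_one, S.state_of_event this]
    simp only [Event.proc, Function.update_self, step, if_neg hp, S.state_before_wake le_rfl]
  | succ k hk ih =>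
    have := S.event_lt ⟨k, by omega⟩
    simp only at this
    split_ifs at this with ha
    · rw [S.state_of_event this, Function.update_of_ne, ih (by omega)]
      intro hpk
      have := congrArg Fin.val hpk
      simp only [Event.proc] at this
      omega
    · rw [S.run_succ_none this, ih (by omega)]

end Script

/-- The state of `p` in state `s` after the receipt of those messages of `l` that are sent to it;
`l` consists of recipients, senders and messages. -/
def receive (A : Algorithm.{u, v, w} n V D) (p : Fin n) (s : A.State)
    (l : List (Fin n × Fin n × A.Msg)) : A.State :=
  l.foldl (fun s x => if x.1 = p then (A.recv p s x.2.1 x.2.2).1 else s) s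

theorem receive_append (A : Algorithm.{u, v, w} n V D) (p : Fin n) (s : A.State)
    (l l' : List (Fin n × Fin n × A.Msg)) :
    A.receive p s (l ++ l') = A.receive p (A.receive p s l) l' := by
  simp [receive]

theorem receive_of_ne (A : Algorithm.{u, v, w} n V D) (p : Fin n) (s : A.State)
    (l : List (Fin n × Fin n × A.Msg)) (h : ∀ x ∈ l, x.1 ≠ p) : A.receive p s l = s := by
  induction l with
  | nil => rfl
  | cons x l ih =>
    simp only [receive, List.foldl_cons] at ih ⊢
    rw [if_neg (h x (by simp))]
    exact ih fun y hy => h y (by simp [hy])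

/-- Later messages queue up behind the prescribed order, so during that order the state is a fold
over first messages alone. -/
theorem Script.state_first {A : Algorithm.{u, v, w} n V D} (S : A.Script) {p : Fin n}
    (hp : p ∉ S.faulty) {a : ℕ} (ha : a ≤ S.order.length) :
    (S.run (n + a)).1 p =
      A.receive p (A.wake p (A.init p (S.input p))).1 (S.order.take a) := by
  induction a with
  | zero => simpa [receive] using S.state_awake hp p.isLt le_rfl
  | succ a ih =>
    have hx := List.getElem?_eq_getElem (l := S.order) (i := a) (by omega)
    rw [← add_assoc, S.state_of_event (S.event_first hx), List.take_add_one, hx, receive_append,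
      ← ih (by omega)]
    set x := S.order[a]
    by_cases hxp : x.1 = p
    · subst hxp
      simp [receive, Event.proc, step]
    · rw [Function.update_of_ne (by simpa [Event.proc, eq_comm] using hxp)]
      simp [receive, hxp]

/-- Lets a script prescribe only the beginning of the order of receipt; the remaining first messages
follow in some order. -/
theorem exists_completion {M : Type w} (P : Fin n → Fin n → Finset M)
    (l : List (Fin n × Fin n × M)) (hl : l.Nodup) (hP : ∀ x ∈ l, x.2.2 ∈ P x.1 x.2.1) :
    ∃ l', (l ++ l').Nodup ∧ ∀ p q m, (p, q, m) ∈ l ++ l' ↔ m ∈ P p q := by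
  classical
  let T : Finset (Fin n × Fin n × M) :=
    Finset.univ.biUnion fun p => Finset.univ.biUnion fun q => (P p q).image fun m => (p, q, m)
  have hT : ∀ p q m, (p, q, m) ∈ T ↔ m ∈ P p q := by
    intro p q m
    simp [T]
  refine ⟨(T \ l.toFinset).toList, ?_, ?_⟩
  · rw [List.nodup_append']
    refine ⟨hl, Finset.nodup_toList _, ?_⟩
    intro x hx hx'
    simp at hx'
    exact hx'.2 hx
  · intro p q m
    have := hP (p, q, m)
    simp [hT] at this ⊢
    tauto

end Algorithm

/-! ### Time complexity at least 2 by stretching delays -/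

namespace Algorithm

variable {n : ℕ} {V : Type u} {D : Type v}

theorem Execution.decision_mono {A : Algorithm.{u, v, w} n V D} {mode : FailureMode} {f : ℕ}
    (E : A.Execution mode f) {p : Fin n} (hp : E.Bound p) {d : D} {i k : ℕ} (h : i ≤ k)
    (hd : A.decision p (E.state i p) = some d) : A.decision p (E.state k p) = some d := by
  induction k, h using Nat.le_induction with
  | base => exact hd
  | succ k _ ih =>
    cases he : E.event k with
    | none => rwa [(E.step_none k he).1]
    | some e =>
      by_cases hpe : p = e.proc
      · subst hpe
        rw [show E.state (k + 1) e.proc = _ from congrArg Prod.fst (E.step_honest k e he hp)]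
        cases e with
        | wake p => exact A.decision_wake _ _ _ ih
        | recv p q j m => exact A.decision_recv _ _ _ _ _ ih
      · rwa [E.step_other k e he p hpe]

/-- Decisions persist, so there is a least index at which all correct processes have decided. The
event just before it must be a step of the correct process that decides last. -/
theorem Execution.exists_last_decision {A : Algorithm.{u, v, w} n V D} {mode : FailureMode}
    {f : ℕ} (E : A.Execution mode f) (ht : ∀ p, p ∉ E.faulty → ∃ d, E.Decides p d) {K : ℕ}
    (hK : ¬ E.AllDecided K) :
    ∃ N, K ≤ N ∧ IsLeast {k | E.AllDecided k} (N + 1) ∧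
      ∃ e, E.event N = some e ∧ e.proc ∉ E.faulty := by
  classical
  have hmono : ∀ {i k}, i ≤ k → E.AllDecided i → E.AllDecided k := fun h hi p hp =>
    (hi p hp).imp fun d hd => E.decision_mono (Or.inr hp) h hd
  have hex : ∃ k, E.AllDecided k := by
    have : ∀ p, ∃ k, p ∉ E.faulty → ∃ d, A.decision p (E.state k p) = some d := by
      intro p
      by_cases hp : p ∈ E.faulty
      · exact ⟨0, fun h => absurd hp h⟩
      · obtain ⟨d, k, hk⟩ := ht p hp
        exact ⟨k, fun _ => ⟨d, hk⟩⟩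
    choose k hk using this
    refine ⟨Finset.univ.sup k, fun p hp => ?_⟩
    obtain ⟨d, hd⟩ := hk p hp
    exact ⟨d, E.decision_mono (Or.inr hp) (Finset.le_sup (Finset.mem_univ p)) hd⟩
  have hKN : K < Nat.find hex := by
    by_contra h
    exact hK (hmono (not_lt.1 h) (Nat.find_spec hex))
  obtain ⟨N, hN⟩ : ∃ N, Nat.find hex = N + 1 := ⟨Nat.find hex - 1, by omega⟩
  have hleast : IsLeast {k | E.AllDecided k} (N + 1) :=
    hN ▸ ⟨Nat.find_spec hex, fun k hk => Nat.find_min' hex hk⟩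
  refine ⟨N, by omega, hleast, ?_⟩
  have hnot : ¬ E.AllDecided N := fun h => by
    have := hleast.2 h
    omega
  unfold Execution.AllDecided at hnot
  push Not at hnot
  obtain ⟨p, hp, hpN⟩ := hnot
  obtain ⟨d, hd⟩ := hleast.1 p hp
  cases he : E.event N with
  | none =>
    rw [(E.step_none N he).1] at hd
    exact absurd hd (hpN d)
  | some e =>
    refine ⟨e, rfl, ?_⟩
    have hpe : p = e.proc := by
      by_contra h
      rw [E.step_other N e he p h] at hd
      exact hpN d hd
    rwa [← hpe]

theorem _root_.ENNReal.two_le_of_forall_ratio {T : ℝ≥0∞} {c : ℕ}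
    (h : ∀ L : ℕ, ∃ a δ : ℕ, 2 * L ≤ a ∧ 0 < δ ∧ δ ≤ L + c ∧ (a : ℝ≥0∞) / (δ : ℝ≥0∞) ≤ T) :
    2 ≤ T := by
  by_contra hT
  push Not at hT
  lift T to NNReal using (hT.trans (by simp)).ne
  have hT2 : (T : ℝ) < 2 := by exact_mod_cast hT
  -- This makes `2 * L > T * (L + c)`, against `a ≤ T * δ`.
  obtain ⟨L, hL⟩ := exists_nat_gt ((T : ℝ) * c / (2 - T))
  obtain ⟨a, δ, ha, hδ, hδL, hle⟩ := h L
  rw [ENNReal.div_le_iff (by exact_mod_cast hδ.ne') (by simp)] at hle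
  have hle' : (a : ℝ) ≤ T * δ := by exact_mod_cast hle
  rw [div_lt_iff₀ (by linarith)] at hL
  have h1 : (2 * L : ℝ) ≤ a := by exact_mod_cast ha
  have h2 : (δ : ℝ) ≤ L + c := by exact_mod_cast hδL
  have h3 : (T : ℝ) * δ ≤ T * (L + c) := mul_le_mul_of_nonneg_left h2 T.2
  nlinarith

/-- If faulty processes never wake up and some correct process has not decided when all first
messages have been received, then the time complexity is at least 2. -/
theorem Script.two_le_timeComplexity {A : Algorithm.{u, v, w} n V D} (S : A.Script)
    {mode : FailureMode} {f : ℕ} (hf : S.faulty.card ≤ f)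
    (hawake : ∀ p ∈ S.awake, p ∉ S.faulty)
    (ht : ∀ p, p ∉ S.faulty → ∃ d, (S.execution mode f hf fun _ => hawake).Decides p d)
    (hK : ¬ (S.execution mode f hf fun _ => hawake).AllDecided (n + S.order.length)) :
    2 ≤ A.timeComplexity mode f := by
  set E := S.execution mode f hf fun _ => hawake with hE
  obtain ⟨N, hKN, hleast, e, he, hpe⟩ := E.exists_last_decision ht hK
  have hcorrect : ∀ {k p q j m}, S.event k = some (.recv p q j m) →
      p ∉ S.faulty ∧ q ∉ S.faulty := by
    intro k p q j m h
    refine ⟨(S.mem_run (S.mem_of_event h)).1, ?_⟩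
    obtain ⟨-, ⟨e', he', rfl⟩, -⟩ := E.recv_sent k p q j m h
    cases e' with
    | wake q => exact hawake q (S.event_wake he').2
    | recv q _ _ _ => exact (S.mem_run (S.mem_of_event he')).1
  have hfirst : ∀ {k p q j m}, S.event k = some (.recv p q j m) → j < n →
      k < n + S.order.length := by
    intro k p q j m h hj
    obtain ⟨hp, ⟨rfl, h2⟩ | ⟨h2, -⟩⟩ := S.mem_run (S.mem_of_event h)
    · obtain ⟨i, hi, hi'⟩ := List.getElem_of_mem ((S.mem_order p q m).2 ⟨hp, h2⟩)
      have := S.event_first (List.getElem?_eq_some_iff.2 ⟨hi, hi'⟩)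
      rw [← S.event_inj this h]
      omega
    · omega
  -- A bound on the receipt index that does not depend on `L`; it becomes the constant `c`.
  have hbound : ∀ {k p q j m}, S.event k = some (.recv p q j m) → j ≤ N →
      k < (S.run (N + 1)).2.length := by
    intro k p q j m h hj
    obtain ⟨-, ⟨e', he', rfl⟩, hm⟩ := E.recv_sent k p q j m h
    obtain ⟨i, hi, hi'⟩ := S.event_of_mem (S.mem_run_of_sent he' (hcorrect h).1 hm)
    rw [← S.event_inj hi' h]
    exact hi.trans_le (S.run_prefix (by omega)).length_le
  refine ENNReal.two_le_of_forall_ratio (c := (S.run (N + 1)).2.length) fun L => ?_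
  -- Wakeups happen at time 0, receipts of first messages after a gap of `L`, and everything else
  -- after a second gap; the summand `k` separates the steps of a process. First messages all arrive
  -- before the second gap, so no message spans both gaps.
  let time : ℕ → ℕ := fun k =>
    if k < n then 0 else if k < n + S.order.length then L + k else 2 * L + k
  have htime : E.IsTiming time := by
    refine ⟨?_, ?_, ?_⟩
    · intro i k hik
      simp only [time]
      split_ifs <;> omega
    · intro i k e e' hik hi hk hee
      by_cases hkn : k < n
      · exfalso
        have h1 := S.event_lt ⟨i, by omega⟩
        have h2 := S.event_lt ⟨k, by omega⟩
        simp only at h1 h2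
        change S.event i = some e at hi
        change S.event k = some e' at hk
        rw [hi] at h1
        rw [hk] at h2
        split_ifs at h1 h2
        rw [Option.some.inj h1, Option.some.inj h2] at hee
        simp only [Event.proc, Fin.mk.injEq] at hee
        omega
      · simp only [time]
        split_ifs <;> omega
    · intro k p hk _
      obtain ⟨rfl, -⟩ := S.event_wake hk
      simp [time]
  have hN : n ≤ N := by omega
  -- Event `N` itself supplies a positive delay, as scaling requires: it is the receipt of a message
  -- that was not sent on wakeup.
  have hdelay : ∃ δ ∈ E.delays time N, 0 < δ := by
    cases e with
    | wake p =>
      have := (S.event_wake he).1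
      omega
    | recv p q j m =>
      refine ⟨_, ⟨N, p, q, j, m, he, (hcorrect he).1, (hcorrect he).2,
        (E.recv_sent N p q j m he).1.le, rfl⟩, ?_⟩
      have hj := (E.recv_sent N p q j m he).1
      have hjn : ¬ j < n := fun h => by
        have := hfirst he h
        omega
      simp only [time]
      split_ifs <;> omega
  have hle : ∀ δ ∈ E.delays time N, δ ≤ L + (S.run (N + 1)).2.length := by
    rintro δ ⟨k, p, q, j, m, hk, hp, hq, hj, rfl⟩
    have h1 := hbound hk hj
    have h2 := S.event_recv_ge hk
    have h3 := (E.recv_sent k p q j m hk).1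
    have h4 := hfirst hk
    simp only [time]
    split_ifs <;> omega
  obtain ⟨δ₀, hδ₀, hpos⟩ := hdelay
  have hbdd : BddAbove (E.delays time N) := ⟨_, hle⟩
  have hmem := Nat.sSup_mem ⟨δ₀, hδ₀⟩ hbdd
  refine ⟨time N, sSup (E.delays time N), ?_, hpos.trans_le (le_csSup hbdd hδ₀), hle _ hmem, ?_⟩
  · simp only [time]
    split_ifs <;> omega
  · exact le_sSup ⟨E, time, N, _, htime, hleast, ⟨hmem, fun _ h => le_csSup hbdd h⟩,
      hpos.trans_le (le_csSup hbdd hδ₀), rfl⟩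

/-! ### Decisions after one round -/

/-- The messages that `p` receives from processes that send what they would send on wakeup with
the inputs given by `x`; a process without a value sends nothing. -/
noncomputable def inbox (A : Algorithm.{u, v, w} n V D) (p : Fin n) (x : Fin n → Option V) :
    List (Fin n × Fin n × A.Msg) :=
  (List.finRange n).flatMap fun q =>
    ((x q).elim ∅ fun u => (A.wake q (A.init q u)).2 p).toList.map fun m => (p, q, m)

/-- The state of `p` with input `v` after its wakeup and the receipt of `inbox p x`. -/
noncomputable def view (A : Algorithm.{u, v, w} n V D) (p : Fin n) (v : V)
    (x : Fin n → Option V) : A.State :=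
  A.receive p (A.wake p (A.init p v)).1 (A.inbox p x)

theorem mem_inbox {A : Algorithm.{u, v, w} n V D} {p : Fin n} {x : Fin n → Option V}
    {y : Fin n × Fin n × A.Msg} :
    y ∈ A.inbox p x ↔ y.1 = p ∧ ∃ u, x y.2.1 = some u ∧
      y.2.2 ∈ (A.wake y.2.1 (A.init y.2.1 u)).2 p := by
  obtain ⟨r, q, m⟩ := y
  simp only [inbox, List.mem_flatMap, List.mem_finRange, true_and, List.mem_map,
    Finset.mem_toList, Prod.mk.injEq]
  constructor
  · rintro ⟨q, m, hm, rfl, rfl, rfl⟩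
    cases hx : x q with
    | none => simp [hx] at hm
    | some u => exact ⟨rfl, u, rfl, by simpa [hx] using hm⟩
  · rintro ⟨rfl, u, hx, hm⟩
    exact ⟨q, m, by simpa [hx] using hm, rfl, rfl, rfl⟩

theorem inbox_nodup (A : Algorithm.{u, v, w} n V D) (p : Fin n) (x : Fin n → Option V) :
    (A.inbox p x).Nodup := by
  rw [inbox, List.nodup_flatMap]
  refine ⟨fun q _ => (Finset.nodup_toList _).map ?_, ?_⟩
  · intro m m' h
    simpa using h
  · refine (List.nodup_finRange n).imp ?_
    intro q q' hq y hy hy'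
    simp only [List.mem_map] at hy hy'
    obtain ⟨m, -, rfl⟩ := hy
    obtain ⟨m', -, h⟩ := hy'
    simp only [Prod.mk.injEq] at h
    exact hq h.2.1.symm

/-- Two different correct processes can have any two views that agree with the inputs of the
correct processes in one execution. -/
theorem exists_execution_of_views (A : Algorithm.{u, v, w} n V D) {mode : FailureMode} {f : ℕ}
    (F : Finset (Fin n)) (hF : F.card ≤ f) (hcrash : mode = .crash → F = ∅) (input : Fin n → V)
    {p p' : Fin n} (hpp : p ≠ p') (hp : p ∉ F) (hp' : p' ∉ F) (x x' : Fin n → Option V)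
    (hx : ∀ q, q ∉ F → ∀ u, x q = some u → u = input q)
    (hx' : ∀ q, q ∉ F → ∀ u, x' q = some u → u = input q) :
    ∃ E : A.Execution mode f, E.input = input ∧ E.faulty = F ∧
      (∀ d, A.decision p (A.view p (input p) x) = some d → E.Decides p d) ∧
      (∀ d, A.decision p' (A.view p' (input p') x') = some d → E.Decides p' d) := by
  -- Faulty processes are two-faced: towards `p` they act as if the inputs were `x`, towards all
  -- others as if they were `x'`.
  let first : Fin n → Fin n → Finset A.Msg := fun q r =>
    if q ∈ F then (if r = p then x q else x' q).elim ∅ fun u => (A.wake q (A.init q u)).2 r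
    else (A.wake q (A.init q (input q))).2 r
  have hsub : ∀ y ∈ A.inbox p x ++ A.inbox p' x',
      y.2.2 ∈ if y.1 ∈ F then ∅ else first y.2.1 y.1 := by
    rintro ⟨r, q, m⟩ hy
    rcases List.mem_append.1 hy with hy | hy
    · obtain ⟨rfl, u, hu, hm⟩ := mem_inbox.1 hy
      simp only at hu hm hp ⊢
      rw [if_neg hp]
      by_cases hq : q ∈ F
      · simpa [first, hq, hu] using hm
      · rw [hx q hq u hu] at hm
        simpa [first, hq] using hm
    · obtain ⟨rfl, u, hu, hm⟩ := mem_inbox.1 hy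
      simp only at hu hm hpp hp' ⊢
      rw [if_neg hp']
      by_cases hq : q ∈ F
      · simpa [first, hq, hu, hpp.symm] using hm
      · rw [hx' q hq u hu] at hm
        simpa [first, hq] using hm
  obtain ⟨l, hl, hmem⟩ := exists_completion (fun r q => if r ∈ F then ∅ else first q r)
    (A.inbox p x ++ A.inbox p' x') (by
      rw [List.nodup_append']
      refine ⟨inbox_nodup _ _ _, inbox_nodup _ _ _, fun y hy hy' => hpp ?_⟩
      rw [← (mem_inbox.1 hy).1, ← (mem_inbox.1 hy').1]) hsub
  let S : A.Script :=
    { input := input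
      faulty := F
      awake := Finset.univ
      correct_awake := fun _ _ => Finset.mem_univ _
      first := first
      first_correct := fun q hq => by simp [first, hq]
      -- Messages of correct processes that a view omits are merely late: they are in `l`.
      order := A.inbox p x ++ A.inbox p' x' ++ l
      order_nodup := hl
      mem_order := fun r q m => by
        rw [hmem]
        by_cases hr : r ∈ F <;> simp [hr] }
  refine ⟨S.execution mode f hF (fun h => by simp [S, hcrash h]), rfl, rfl, ?_, ?_⟩
  · intro d hd
    refine ⟨n + (A.inbox p x).length, ?_⟩
    change A.decision p ((S.run _).1 p) = some d
    rw [S.state_first hp (by simp [S]), ← hd]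
    simp only [S, List.append_assoc, List.take_left]
    rfl
  · intro d hd
    refine ⟨n + (A.inbox p x ++ A.inbox p' x').length, ?_⟩
    change A.decision p' ((S.run _).1 p') = some d
    rw [S.state_first hp' (by simp [S]), ← hd]
    simp only [S, List.take_left]
    rw [receive_append, receive_of_ne _ _ _ (A.inbox p x)]
    · rfl
    · intro y hy
      rw [(mem_inbox.1 hy).1]
      exact hpp

/-- If one round suffices, or the time complexity is below 2, then a process decides as soon as
it has received the first messages of all processes outside a set of `f` processes. -/
theorem exists_decision_view {A : Algorithm.{u, v, w} n V D} {mode : FailureMode} {f : ℕ}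
    (ht : ∀ (E : A.Execution mode f) (p : Fin n), p ∉ E.faulty → ∃ d, E.Decides p d)
    (h : A.DecidesInOneRound mode f ∨ ¬ 2 ≤ A.timeComplexity mode f)
    (F : Finset (Fin n)) (hF : F.card ≤ f) (input : Fin n → V) {p : Fin n} (hp : p ∉ F) :
    ∃ d, A.decision p
      (A.view p (input p) fun q => if q ∈ F then none else some (input q)) = some d := by
  set x : Fin n → Option V := fun q => if q ∈ F then none else some (input q) with hx
  let P : Fin n → Fin n → Finset A.Msg := fun r q =>
    if r ∈ F ∨ q ∈ F then ∅ else (A.wake q (A.init q (input q))).2 r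
  obtain ⟨l, hl, hmem⟩ := exists_completion P (A.inbox p x) (inbox_nodup _ _ _) (by
    rintro ⟨r, q, m⟩ hy
    obtain ⟨rfl, u, hu, hm⟩ := mem_inbox.1 hy
    simp only [hx] at hu hm hp ⊢
    split_ifs at hu with hq
    cases hu
    simpa [P, hp, hq] using hm)
  let S : A.Script :=
    { input := input
      faulty := F
      -- The processes of `F` never wake up, which is possible in both failure modes.
      awake := Fᶜ
      correct_awake := fun _ h => Finset.mem_compl.2 h
      first := fun q => (A.wake q (A.init q (input q))).2
      first_correct := fun q hq => rfl
      order := A.inbox p x ++ l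
      order_nodup := hl
      mem_order := fun r q m => by
        rw [hmem]
        by_cases hr : r ∈ F <;> by_cases hq : q ∈ F <;> simp [P, hr, hq] }
  have hawake : ∀ q ∈ S.awake, q ∉ S.faulty := fun q => Finset.mem_compl.1
  have hrest : ∀ y ∈ l, y.1 ≠ p := by
    rintro ⟨r, q, m⟩ hy rfl
    have h1 := (hmem _ q m).1 (List.mem_append_right _ hy)
    simp only at h1 hp
    have hq : q ∉ F := fun hq => by simp [P, hq] at h1
    have : (r, q, m) ∈ A.inbox r x :=
      mem_inbox.2 ⟨rfl, input q, by simp [hx, hq], by simpa [P, hp, hq] using h1⟩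
    exact (List.nodup_append'.1 hl).2.2 this hy
  -- The inbox already contains every first message to `p`, so `p` keeps its view until the
  -- prescribed order ends. The one-round case uses the beginning of this interval, the time bound
  -- its end.
  have hstate : ∀ a, (A.inbox p x).length ≤ a → a ≤ S.order.length →
      (S.run (n + a)).1 p = A.view p (input p) x := by
    intro a h1 h2
    rw [S.state_first hp h2]
    have : S.order.take a = A.inbox p x ++ l.take (a - (A.inbox p x).length) := by
      simp only [S]
      rw [List.take_append, List.take_of_length_le h1]
    rw [this, receive_append, receive_of_ne _ _ _ (l.take _)]
    · rfl
    · exact fun y hy => hrest y (List.mem_of_mem_take hy)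
  rcases h with h | h
  · have := h (S.execution mode f hF fun _ => hawake) p (n + (A.inbox p x).length) hp ?_
    · change ∃ d, A.decision p ((S.run _).1 p) = some d at this
      rwa [hstate _ le_rfl (by simp [S])] at this
    · intro q hq
      refine ⟨q, by omega, ?_, ?_⟩
      · change S.event q = _
        rw [S.event_lt, if_pos (S.correct_awake q hq)]
      · intro m hm
        change m ∈ S.sent q p at hm
        rw [S.sent_lt (S.correct_awake q hq)] at hm
        have hq' : q ∉ F := hq
        obtain ⟨i, hi, hi'⟩ := List.getElem_of_mem
          ((mem_inbox (A := A) (p := p) (x := x) (y := (p, q, m))).2 ⟨rfl, input q, by simp [hx, hq'], hm⟩)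
        refine ⟨n + i, by omega, S.event_first (x := (p, q, m)) ?_⟩
        simp only [S]
        rw [List.getElem?_append_left hi, List.getElem?_eq_some_iff]
        exact ⟨hi, hi'⟩
  · by_contra hne
    refine h (S.two_le_timeComplexity hF hawake (fun q hq => ht _ q hq) fun hall => hne ?_)
    have := hall p hp
    change ∃ d, A.decision p ((S.run _).1 p) = some d at this
    rwa [hstate _ (by simp [S]) le_rfl] at this

end Algorithm

/-! ### The spider graph for `R = 2` -/

section Spider

variable {V : Type u}

theorem spiderGraph_adj {x y : SpiderVertex V 2} : (spiderGraph V 2).Adj x y ↔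
    ∃ v, s(x, y) = s(.center, .branch v 0) ∨ s(x, y) = s(.branch v 0, .branch v 1) := by
  cases x with
  | center =>
    cases y with
    | center => simp [spiderGraph]
    | branch w j => fin_cases j <;> simp [spiderGraph]
  | branch v i =>
    cases y with
    | center => fin_cases i <;> simp [spiderGraph]
    | branch w j => fin_cases i <;> fin_cases j <;> simp [spiderGraph, eq_comm]

theorem spider_dist_of_branch {v : V} {i : Fin 2} {x : SpiderVertex V 2}
    (h : (spiderGraph V 2).edist (.branch v i) x ≤ 1) : x = .center ∨ ∃ j, x = .branch v j := by
  rw [SimpleGraph.edist_le_one_iff_adj_or_eq, spiderGraph_adj] at h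
  rcases h with ⟨w, h⟩ | rfl
  · cases x with
    | center => exact Or.inl rfl
    | branch u j =>
      right
      simp at h
      aesop
  · exact Or.inr ⟨_, rfl⟩

theorem spider_dist_of_leaf {v : V} {x : SpiderVertex V 2}
    (h : (spiderGraph V 2).edist (.branch v 1) x ≤ 1) : ∃ j, x = .branch v j := by
  rw [SimpleGraph.edist_le_one_iff_adj_or_eq, spiderGraph_adj] at h
  rcases h with ⟨w, h⟩ | rfl
  · cases x with
    | center => simp at h
    | branch u j =>
      simp at h
      aesop
  · exact ⟨_, rfl⟩

/-- Leaves of different branches are at distance more than 3. -/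
theorem spider_leaf_eq_of_chain {v w : V} {x y : SpiderVertex V 2}
    (h1 : (spiderGraph V 2).edist (.branch v 1) x ≤ 1) (h2 : (spiderGraph V 2).edist x y ≤ 1)
    (h3 : (spiderGraph V 2).edist y (.branch w 1) ≤ 1) : v = w := by
  obtain ⟨i, rfl⟩ := spider_dist_of_leaf h1
  rw [SimpleGraph.edist_comm] at h3
  obtain ⟨j, rfl⟩ := spider_dist_of_leaf h3
  rcases spider_dist_of_branch h2 with h | ⟨k, h⟩
  · cases h
  · cases h
    rfl

theorem mem_spiderLeaves {I : Set V} {x : SpiderVertex V 2} :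
    x ∈ spiderLeaves 2 I ↔ ∃ v ∈ I, x = .branch v 1 := by
  constructor
  · rintro ⟨v, hv, i, hi, rfl⟩
    exact ⟨v, hv, by congr 1; ext; simp; omega⟩
  · rintro ⟨v, hv, rfl⟩
    exact ⟨v, hv, 1, rfl, rfl⟩

theorem eq_leaf_of_mem_spiderSubtree {I : Set V} {v : V} (hI : ∀ u ∈ I, u = v)
    {d : SpiderVertex V 2} (hd : d ∈ spiderSubtree 2 I) : d = .branch v 1 := by
  refine hd {.branch v 1} ?_ ?_
  · intro x hx
    obtain ⟨u, hu, rfl⟩ := mem_spiderLeaves.1 hx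
    rw [hI u hu]
    rfl
  · rintro ⟨a, rfl⟩ ⟨b, rfl⟩
    rfl

theorem leaf_mem_spiderSubtree {I : Set V} {v : V} (hv : v ∈ I) :
    .branch v 1 ∈ spiderSubtree 2 I := fun _ hS _ => hS (mem_spiderLeaves.2 ⟨v, hv, rfl⟩)

theorem SimpleGraph.mem_of_reachable {W : Type u} {G : SimpleGraph W} {C : Set W}
    (hC : ∀ x ∈ C, ∀ y, G.Adj x y → y ∈ C) {x y : W} (h : G.Reachable x y) (hx : x ∈ C) :
    y ∈ C := by
  obtain ⟨p⟩ := h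
  induction p with
  | nil => exact hx
  | cons hadj _ ih => exact ih (hC _ hx _ hadj)

/-- Both vertices are cut vertices: without `(v, 1)` the leaf `(v, 2)` is isolated, and without the
center the path of `v` is separated from the other leaf. -/
theorem inner_mem_spiderSubtree {I : Set V} {v w : V} (hv : v ∈ I) (hw : w ∈ I) (hvw : v ≠ w) :
    .branch v 0 ∈ spiderSubtree 2 I ∧ .center ∈ spiderSubtree 2 I := by
  have key : ∀ S : Set (SpiderVertex V 2), spiderLeaves 2 I ⊆ S →
      ((spiderGraph V 2).induce S).Preconnected → .branch v 0 ∈ S ∧ .center ∈ S := by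
    intro S hS hconn
    have h1 : .branch v 1 ∈ S := hS (mem_spiderLeaves.2 ⟨v, hv, rfl⟩)
    have h2 : .branch w 1 ∈ S := hS (mem_spiderLeaves.2 ⟨w, hw, rfl⟩)
    have h := hconn ⟨_, h1⟩ ⟨_, h2⟩
    constructor
    · by_contra hn
      have := SimpleGraph.mem_of_reachable (C := {x | x.1 = .branch v 1}) ?_ h
        (show _ = _ from rfl)
      · simp [hvw.symm] at this
      · rintro ⟨x, hx⟩ (rfl : x = _) ⟨y, hy⟩ hadj
        exfalso
        simp only [SimpleGraph.comap_adj, Function.Embedding.subtype_apply] at hadj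
        rw [spiderGraph_adj] at hadj
        simp at hadj
        aesop
    · by_contra hn
      have := SimpleGraph.mem_of_reachable (C := {x | ∃ i, x.1 = .branch v i}) ?_ h ⟨_, rfl⟩
      · simp [hvw.symm] at this
      · rintro ⟨x, hx⟩ ⟨i, (rfl : x = _)⟩ ⟨y, hy⟩ hadj
        simp only [SimpleGraph.comap_adj, Function.Embedding.subtype_apply] at hadj
        rcases spider_dist_of_branch
          (SimpleGraph.edist_le_one_iff_adj_or_eq.2 (Or.inl hadj)) with h | h
        · exact absurd (h ▸ hy) hn
        · exact h
  exact ⟨fun S hS hc => (key S hS hc).1, fun S hS hc => (key S hS hc).2⟩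

end Spider

/-! ### One round does not suffice -/

namespace Algorithm

variable {n : ℕ} {V : Type u}

section Views

variable {A : Algorithm.{u, u, w} n V (SpiderVertex V 2)} {mode : FailureMode} {f : ℕ}

theorem SolvesConnectedConsensus.edist_views (hA : A.SolvesConnectedConsensus mode f)
    (F : Finset (Fin n)) (hF : F.card ≤ f) (hcrash : mode = .crash → F = ∅) (input : Fin n → V)
    {p p' : Fin n} (hpp : p ≠ p') (hp : p ∉ F) (hp' : p' ∉ F) {v v' : V} {x x' : Fin n → Option V}
    (hv : v = input p) (hv' : v' = input p')
    (hx : ∀ q, q ∉ F → ∀ u, x q = some u → u = input q)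
    (hx' : ∀ q, q ∉ F → ∀ u, x' q = some u → u = input q) {d d' : SpiderVertex V 2}
    (hd : A.decision p (A.view p v x) = some d)
    (hd' : A.decision p' (A.view p' v' x') = some d') : (spiderGraph V 2).edist d d' ≤ 1 := by
  subst hv hv'
  obtain ⟨E, -, rfl, h1, h2⟩ :=
    exists_execution_of_views A F hF hcrash input hpp hp hp' x x' hx hx'
  exact hA.agreement E p p' d d' (Or.inr hp) (Or.inr hp') (h1 d hd) (h2 d' hd')

/-- The view also fits an execution in which every input is `v`, and there the subtree is a single
leaf. The second process `p'` only fills the other place in `exists_execution_of_views`, with an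
empty view. -/
theorem SolvesConnectedConsensus.eq_leaf_of_view (hA : A.SolvesConnectedConsensus mode f)
    (F : Finset (Fin n)) (hF : F.card ≤ f) (hcrash : mode = .crash → F = ∅) {p p' : Fin n}
    (hpp : p ≠ p') (hp : p ∉ F) (hp' : p' ∉ F) {v v' : V} {x : Fin n → Option V} (hv : v' = v)
    (hx : ∀ q, q ∉ F → ∀ u, x q = some u → u = v) {d : SpiderVertex V 2}
    (hd : A.decision p (A.view p v' x) = some d) : d = .branch v 1 := by
  subst hv
  obtain ⟨E, hE, hEF, h1, -⟩ := exists_execution_of_views A F hF hcrash (fun _ => v') hpp hp hp' x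
    (fun _ => none) hx (by simp)
  refine eq_leaf_of_mem_spiderSubtree ?_
    (hA.validity E p d (Or.inr (hEF ▸ hp)) (h1 d hd))
  rintro _ ⟨q, -, rfl⟩
  rw [hE]

end Views

/-- On one block `x ↦ x / m` is injective, because coprimality recovers the residue of `x`, and its
values are below `f`. The affine map serves to put chosen processes into chosen blocks. -/
theorem card_block_le {f m c s r : ℕ} (hn : n ≤ m * f) (hc : c.Coprime m) :
    (Finset.univ.filter fun x : Fin n => (c * x.val + s) % m = r).card ≤ f := by
  rw [← Finset.card_range f]
  refine Finset.card_le_card_of_injOn (fun x => x.val / m) ?_ ?_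
  · intro x _
    have := x.isLt
    simp only [Finset.coe_range, Set.mem_Iio]
    exact Nat.div_lt_of_lt_mul (by omega)
  · intro x hx y hy hxy
    simp only [Finset.coe_filter, Finset.mem_univ, true_and, Set.mem_ofPred_eq] at hx hy hxy
    have h : x.val % m = y.val % m :=
      Nat.ModEq.cancel_left_of_coprime (Nat.Coprime.symm hc)
        (Nat.ModEq.add_right_cancel' s (hx.trans hy.symm))
    ext
    rw [← Nat.div_add_mod x.val m, ← Nat.div_add_mod y.val m, hxy, h]

theorem not_forall_decision_view_crash [Nontrivial V] {f : ℕ} (h2 : 2 ≤ n) (hn : n ≤ 4 * f)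
    {A : Algorithm.{u, u, w} n V (SpiderVertex V 2)} (hA : A.SolvesConnectedConsensus .crash f)
    (H : ∀ (F : Finset (Fin n)), F.card ≤ f → ∀ (input : Fin n → V) (p : Fin n), p ∉ F →
      ∃ d, A.decision p
        (A.view p (input p) fun q => if q ∈ F then none else some (input q)) = some d) :
    False := by
  obtain ⟨v, w, hvw⟩ := exists_pair_ne V
  let B : ℕ → Finset (Fin n) := fun r => Finset.univ.filter fun x => (1 * x.val + 0) % 4 = r
  have hB : ∀ r, (B r).card ≤ f := fun r => card_block_le hn (by norm_num)
  have hmem : ∀ {x r}, x ∈ B r ↔ x.val % 4 = r := by simp [B]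
  let I : ℕ → Fin n → V := fun r x => if x.val % 4 < r then w else v
  have hI : ∀ {r} {q : Fin n}, q ∉ B r → I r q = I (r + 1) q := by
    intro r q hq
    rw [hmem] at hq
    simp only [I]
    split_ifs <;> first | rfl | omega
  -- Process `a` lies in block 1 and decides in views 0 and 2; `b` lies in block 0 and decides in
  -- views 1 and 3. So no one decides without its own block, and neighbouring views belong to
  -- different processes.
  let a : Fin n := ⟨1, by omega⟩
  let b : Fin n := ⟨0, by omega⟩
  have hab : a ≠ b := by simp [a, b]
  have ha : ∀ r, r ≠ 1 → a ∉ B r := fun r hr => by rw [hmem]; simp [a]; omega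
  have hb : ∀ r, r ≠ 0 → b ∉ B r := fun r hr => by rw [hmem]; simp [b]; omega
  have hleft : ∀ r q, q ∉ (∅ : Finset (Fin n)) → ∀ u,
      (if q ∈ B r then none else some (I r q)) = some u → u = I (r + 1) q := by
    intro r q _ u hu
    split_ifs at hu with hq
    rw [← hI hq]
    exact (Option.some.inj hu).symm
  have hright : ∀ r q, q ∉ (∅ : Finset (Fin n)) → ∀ u,
      (if q ∈ B r then none else some (I r q)) = some u → u = I r q := by
    intro r q _ u hu
    split_ifs at hu with hq
    exact (Option.some.inj hu).symm
  have link : ∀ r p p', p ≠ p' → p ∉ B r → ∀ d d',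
      A.decision p (A.view p (I r p) fun q => if q ∈ B r then none else some (I r q)) = some d →
      A.decision p' (A.view p' (I (r + 1) p') fun q => if q ∈ B (r + 1) then none else
        some (I (r + 1) q)) = some d' → (spiderGraph V 2).edist d d' ≤ 1 := by
    intro r p p' hpp hp d d' hd hd'
    exact hA.edist_views ∅ (by simp) (fun _ => rfl) (I (r + 1)) hpp (by simp) (by simp) (hI hp)
      rfl (hleft r) (hright (r + 1)) hd hd'
  obtain ⟨d0, h0⟩ := H (B 0) (hB 0) (I 0) a (ha 0 (by omega))
  obtain ⟨d1, h1⟩ := H (B 1) (hB 1) (I 1) b (hb 1 (by omega))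
  obtain ⟨d2, h2⟩ := H (B 2) (hB 2) (I 2) a (ha 2 (by omega))
  obtain ⟨d3, h3⟩ := H (B 3) (hB 3) (I 3) b (hb 3 (by omega))
  have e0 : d0 = .branch v 1 :=
    hA.eq_leaf_of_view ∅ (by simp) (fun _ => rfl) hab (by simp) (by simp) (by simp [I])
      (fun q hq u hu => by simpa [I] using hright 0 q hq u hu) h0
  -- Outside the silent block 3, `I 3` agrees with `I 4`, which is constantly `w`.
  have e3 : d3 = .branch w 1 :=
    hA.eq_leaf_of_view ∅ (by simp) (fun _ => rfl) hab.symm (by simp) (by simp) (by simp [I, b])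
      (fun q hq u hu => by
        rw [hleft 3 q hq u hu]
        simp only [I]
        exact if_pos (by omega)) h3
  subst e0 e3
  exact hvw (spider_leaf_eq_of_chain (link 0 a b hab (ha 0 (by omega)) _ _ h0 h1)
    (link 1 b a hab.symm (hb 1 (by omega)) _ _ h1 h2)
    (link 2 a b hab (ha 2 (by omega)) _ _ h2 h3))

theorem not_forall_decision_view_malicious [Nontrivial V] {f : ℕ} (h2 : 2 ≤ n) (hn : n ≤ 9 * f)
    {A : Algorithm.{u, u, w} n V (SpiderVertex V 2)}
    (hA : A.SolvesConnectedConsensus .malicious f)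
    (H : ∀ (F : Finset (Fin n)), F.card ≤ f → ∀ (input : Fin n → V) (p : Fin n), p ∉ F →
      ∃ d, A.decision p
        (A.view p (input p) fun q => if q ∈ F then none else some (input q)) = some d) :
    False := by
  obtain ⟨v, w, hvw⟩ := exists_pair_ne V
  -- This map puts process 1 into block 3 and process 0 into block 5. Only even blocks will be
  -- faulty, and blocks 3 and 5 are silent only in a view of the other process.
  let B : ℕ → Finset (Fin n) := fun r => Finset.univ.filter fun x => (7 * x.val + 5) % 9 = r
  have hB : ∀ r, (B r).card ≤ f := fun r => card_block_le hn (by norm_num)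
  have hmem : ∀ {x r}, x ∈ B r ↔ (7 * x.val + 5) % 9 = r := by simp [B]
  let I : ℕ → Fin n → V := fun r x => if (7 * x.val + 5) % 9 < r then w else v
  have hI : ∀ {r} {q : Fin n}, q ∉ B r → I r q = I (r + 1) q := by
    intro r q hq
    rw [hmem] at hq
    simp only [I]
    split_ifs <;> first | rfl | omega
  let a : Fin n := ⟨1, by omega⟩
  let b : Fin n := ⟨0, by omega⟩
  have hab : a ≠ b := by simp [a, b]
  have ha : ∀ r, r ≠ 3 → a ∉ B r := fun r hr => by rw [hmem]; simp [a]; omega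
  have hb : ∀ r, r ≠ 5 → b ∉ B r := fun r hr => by rw [hmem]; simp [b]; omega
  have hleft : ∀ r (q : Fin n) u,
      (if q ∈ B r then none else some (I r q)) = some u → u = I (r + 1) q := by
    intro r q u hu
    split_ifs at hu with hq
    rw [← hI hq]
    exact (Option.some.inj hu).symm
  have hright : ∀ r (q : Fin n) u,
      (if q ∈ B r then none else some (I r q)) = some u → u = I r q := by
    intro r q u hu
    split_ifs at hu with hq
    exact (Option.some.inj hu).symm
  -- The common execution has input `I (r + 1)` and faulty block `r + 1`, which claims `v` to `p`
  -- and `w` to `p'`. The change of input at block `r` is hidden from `p` because that block is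
  -- silent.
  have link : ∀ r p p', p ≠ p' → p ∉ B r → p ∉ B (r + 1) → p' ∉ B (r + 1) → ∀ d d',
      A.decision p (A.view p (I r p) fun q => if q ∈ B r then none else some (I r q)) = some d →
      A.decision p' (A.view p' (I (r + 2) p') fun q => if q ∈ B (r + 2) then none else
        some (I (r + 2) q)) = some d' → (spiderGraph V 2).edist d d' ≤ 1 := by
    intro r p p' hpp hp hp1 hp' d d' hd hd'
    exact hA.edist_views (B (r + 1)) (hB _) (by simp) (I (r + 1)) hpp hp1 hp' (hI hp)
      (hI hp').symm (fun q _ => hleft r q)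
      (fun q hq u hu => (hright (r + 2) q u hu).trans (hI hq).symm) hd hd'
  obtain ⟨d0, h0⟩ := H (B 1) (hB 1) (I 1) a (ha 1 (by omega))
  obtain ⟨d1, h1⟩ := H (B 3) (hB 3) (I 3) b (hb 3 (by omega))
  obtain ⟨d2, h2⟩ := H (B 5) (hB 5) (I 5) a (ha 5 (by omega))
  obtain ⟨d3, h3⟩ := H (B 7) (hB 7) (I 7) b (hb 7 (by omega))
  have hI0 : ∀ q, I 0 q = v := fun q => by simp [I]
  have hI9 : ∀ q, I 9 q = w := fun q => if_pos (by omega)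
  -- In a run with constant input `v`, the faulty block 0 pretends to hold `w`. At the other end,
  -- block 8 pretends to hold `v` while all inputs are `w`.
  have e0 : d0 = .branch v 1 :=
    hA.eq_leaf_of_view (B 0) (hB 0) (by simp) hab (ha 0 (by omega)) (hb 0 (by omega))
      ((hI (ha 0 (by omega))).symm.trans (hI0 a))
      (fun q hq u hu => (hright 1 q u hu).trans ((hI hq).symm.trans (hI0 q))) h0
  have e3 : d3 = .branch w 1 :=
    hA.eq_leaf_of_view (B 8) (hB 8) (by simp) hab.symm (hb 8 (by omega)) (ha 8 (by omega))
      ((hI (hb 7 (by omega))).trans ((hI (hb 8 (by omega))).trans (hI9 b)))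
      (fun q hq u hu => (hleft 7 q u hu).trans ((hI hq).trans (hI9 q))) h3
  subst e0 e3
  exact hvw (spider_leaf_eq_of_chain
    (link 1 a b hab (ha 1 (by omega)) (ha 2 (by omega)) (hb 2 (by omega)) _ _ h0 h1)
    (link 3 b a hab.symm (hb 3 (by omega)) (hb 4 (by omega)) (ha 4 (by omega)) _ _ h1 h2)
    (link 5 a b hab (ha 5 (by omega)) (ha 6 (by omega)) (hb 6 (by omega)) _ _ h2 h3))

theorem SolvesConnectedConsensus.two_rounds_of_views {A : Algorithm.{u, u, w} n V (SpiderVertex V 2)}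
    {mode : FailureMode} {f : ℕ} (hA : A.SolvesConnectedConsensus mode f)
    (H : ¬ ∀ (F : Finset (Fin n)), F.card ≤ f → ∀ (input : Fin n → V) (p : Fin n), p ∉ F →
      ∃ d, A.decision p
        (A.view p (input p) fun q => if q ∈ F then none else some (input q)) = some d) :
    ¬ A.DecidesInOneRound mode f ∧ 2 ≤ A.timeComplexity mode f := by
  constructor
  · exact fun h => H fun F hF input p hp =>
      exists_decision_view hA.termination (Or.inl h) F hF input hp
  · by_contra h
    exact H fun F hF input p hp =>
      exists_decision_view hA.termination (Or.inr h) F hF input hp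

end Algorithm

namespace TwoRound

theorem store_fields {n : ℕ} {V : Type u} (s : State n V) (q : Fin n) (m : Msg V) :
    (store s q m).input = s.input ∧ (store s q m).branch = s.branch ∧
      (store s q m).decision = s.decision := by
  cases m <;> exact ⟨rfl, rfl, rfl⟩

variable {n : ℕ} {V : Type u} [LinearOrder V]

/-! ### The functions `chooseBranch` and `chooseVertex` -/

theorem exists_trim {X : Type u} (t : ℕ) (s : List X) (h : 2 * t ≤ s.length) :
    ∃ l r, l.length = t ∧ r.length = t ∧ s = l ++ (s.drop t).rdrop t ++ r := by
  refine ⟨s.take t, (s.drop t).rtake t, ?_, ?_, ?_⟩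
  · rw [List.length_take]
    omega
  · simp [List.rtake]
    omega
  · rw [List.append_assoc, List.rdrop, List.rtake, List.take_append_drop, List.take_append_drop]

theorem chooseBranch_eq_some {t : ℕ} {l : List V} {v : V} : chooseBranch t l = some v ↔
    (∀ x ∈ ((l.insertionSort (· ≤ ·)).drop t).rdrop t, x = v) ∧
      ((l.insertionSort (· ≤ ·)).drop t).rdrop t ≠ [] := by
  unfold chooseBranch
  cases ((l.insertionSort (· ≤ ·)).drop t).rdrop t with
  | nil => simp
  | cons a s =>
    simp only [List.mem_cons, forall_eq_or_imp, ne_eq, reduceCtorEq, not_false_eq_true, and_true]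
    split_ifs with h
    · simp only [Option.some.injEq]
      constructor
      · rintro rfl
        exact ⟨rfl, h⟩
      · exact fun h => h.1
    · simp only [false_iff, not_and]
      rintro rfl
      exact h

theorem exists_sorted_trim {t : ℕ} {l : List V} (h : 2 * t ≤ l.length) :
    ∃ a c, a.length = t ∧ c.length = t ∧
      l.Perm (a ++ ((l.insertionSort (· ≤ ·)).drop t).rdrop t ++ c) ∧
      (a ++ ((l.insertionSort (· ≤ ·)).drop t).rdrop t ++ c).Pairwise (· ≤ ·) := by
  obtain ⟨a, c, ha, hc, h⟩ := exists_trim t (l.insertionSort (· ≤ ·)) (by simpa using h)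
  refine ⟨a, c, ha, hc, ?_, ?_⟩
  · rw [← h]
    exact (List.perm_insertionSort _ _).symm
  · rw [← h]
    exact List.pairwise_insertionSort _ _

/-- In sorted order, values above `v` can only lie in the dropped upper part and values below `v`
only in the dropped lower part. -/
theorem countP_of_chooseBranch {t : ℕ} {l : List V} {v : V} (ht : 2 * t ≤ l.length)
    (h : chooseBranch t l = some v) :
    l.countP (fun x => decide (v < x)) ≤ t ∧ l.countP (fun x => decide (x < v)) ≤ t := by
  obtain ⟨h1, h2⟩ := chooseBranch_eq_some.1 h
  obtain ⟨a, c, ha, hc, hp, hs⟩ := exists_sorted_trim ht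
  generalize ((l.insertionSort (· ≤ ·)).drop t).rdrop t = m at *
  obtain ⟨x, hx⟩ := List.exists_mem_of_ne_nil m h2
  have hxv := h1 x hx
  subst hxv
  rw [List.pairwise_append, List.pairwise_append] at hs
  obtain ⟨⟨-, -, hs1⟩, -, hs2⟩ := hs
  rw [hp.countP_eq, hp.countP_eq]
  simp only [List.countP_append]
  constructor
  · rw [List.countP_eq_zero.2, List.countP_eq_zero.2]
    · exact (by simpa [hc] using List.countP_le_length (l := c))
    · intro y hy
      simp [h1 y hy]
    · intro y hy
      simpa using hs1 y hy x hx
  · have hm : m.countP (fun y => decide (y < x)) = 0 :=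
      List.countP_eq_zero.2 fun y hy => by simp [h1 y hy]
    have hc : c.countP (fun y => decide (y < x)) = 0 :=
      List.countP_eq_zero.2 fun y hy => by simpa using hs2 x (by simp [hx]) y hy
    rw [hm, hc]
    simpa [ha] using List.countP_le_length (l := a)

/-- A surviving value other than `v` would make a whole dropped end differ from `v` too, which gives
more than `t` exceptions. -/
theorem chooseBranch_of_countP {t : ℕ} {l : List V} {v : V} (ht : 2 * t < l.length)
    (h : l.countP (fun x => decide (x ≠ v)) ≤ t) : chooseBranch t l = some v := by
  rw [chooseBranch_eq_some]
  obtain ⟨a, c, ha, hc, hp, hs⟩ := exists_sorted_trim ht.le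
  generalize ((l.insertionSort (· ≤ ·)).drop t).rdrop t = m at *
  rw [hp.countP_eq] at h
  simp only [List.countP_append] at h
  rw [List.pairwise_append, List.pairwise_append] at hs
  obtain ⟨⟨-, -, hs1⟩, -, hs2⟩ := hs
  constructor
  · intro x hx
    by_contra hxv
    have hm : 0 < m.countP (fun x => decide (x ≠ v)) :=
      List.countP_pos_iff.2 ⟨x, hx, by simpa using hxv⟩
    rcases lt_or_gt_of_ne hxv with hlt | hgt
    · have : a.countP (fun x => decide (x ≠ v)) = a.length :=
        List.countP_eq_length.2 fun y hy => by
          simpa using ((hs1 y hy x hx).trans_lt hlt).ne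
      omega
    · have : c.countP (fun x => decide (x ≠ v)) = c.length :=
        List.countP_eq_length.2 fun y hy => by
          simpa using (hgt.trans_le (hs2 x (by simp [hx]) y hy)).ne'
      omega
  · rintro rfl
    have := hp.length_eq
    simp at this
    omega

theorem mem_reduceOption_of_count {t : ℕ} (ht : 0 < t) {B : List (Option V)} {v : V}
    (h : t ≤ B.count (some v)) : v ∈ B.reduceOption :=
  List.reduceOption_mem_iff.2 (List.count_pos_iff.1 (ht.trans_le h))

/-- The threshold is positive, so a value that reaches it occurs in `B` and the search cannot miss
it. -/
theorem chooseVertex_none {low high : ℕ} (hlow : 0 < low) (B : List (Option V)) :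
    (∃ v, low ≤ B.count (some v) ∧ chooseVertex low high none B = .branch v 0) ∨
      chooseVertex low high none B = .center ∧ ∀ v, B.count (some v) < low := by
  unfold chooseVertex
  cases h : B.reduceOption.find? (fun v => low ≤ B.count (some v)) with
  | some v => exact Or.inl ⟨v, by simpa using List.find?_some h, rfl⟩
  | none =>
    refine Or.inr ⟨rfl, fun v => ?_⟩
    by_contra hv
    simpa [hv] using List.find?_eq_none.1 h v (mem_reduceOption_of_count hlow (not_lt.1 hv))

theorem chooseVertex_some {low high : ℕ} (hhigh : 0 < high) (w : V) (B : List (Option V)) :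
    (∃ v, high ≤ B.count (some v) ∧ chooseVertex low high (some w) B = .branch v 1) ∨
      chooseVertex low high (some w) B = .branch w 0 ∧ ∀ v, B.count (some v) < high := by
  unfold chooseVertex
  cases h : B.reduceOption.find? (fun v => high ≤ B.count (some v)) with
  | some v => exact Or.inl ⟨v, by simpa using List.find?_some h, rfl⟩
  | none =>
    refine Or.inr ⟨rfl, fun v => ?_⟩
    by_contra hv
    simpa [hv] using List.find?_eq_none.1 h v (mem_reduceOption_of_count hhigh (not_lt.1 hv))

/-! ### Samples of received values -/

/-- A list of `m` values from different senders, each of which satisfies `P`. -/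
structure IsSample {X : Type u} (m : ℕ) (P : Fin n → X → Prop) (l : List (Fin n × X)) : Prop where
  length : l.length = m
  nodup : (l.map Prod.fst).Nodup
  prop : ∀ y ∈ l, P y.1 y.2

/-- The senders of the values that satisfy `φ`. -/
def senders {X : Type u} (l : List (Fin n × X)) (φ : X → Bool) : Finset (Fin n) :=
  ((l.filter fun y => φ y.2).map Prod.fst).toFinset

theorem mem_senders {X : Type u} {l : List (Fin n × X)} {φ : X → Bool} {q : Fin n} :
    q ∈ senders l φ ↔ ∃ x, (q, x) ∈ l ∧ φ x = true := by
  simp [senders]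

theorem card_senders {X : Type u} {l : List (Fin n × X)} (h : (l.map Prod.fst).Nodup)
    (φ : X → Bool) : (senders l φ).card = (l.map Prod.snd).countP φ := by
  rw [senders, List.toFinset_card_of_nodup
    (h.sublist (List.Sublist.map _ List.filter_sublist)), List.length_map, List.countP_map,
    List.countP_eq_length_filter]
  rfl

theorem card_senders_true {X : Type u} {l : List (Fin n × X)} (h : (l.map Prod.fst).Nodup) :
    (senders l fun _ => true).card = l.length := by
  rw [card_senders h]
  simp

/-- Two sets whose sizes add up to more than `n + b` meet outside every set of `b` elements. -/
theorem exists_mem_inter {b : ℕ} {S T U : Finset (Fin n)} (hU : U.card ≤ b)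
    (h : n + b < S.card + T.card) : ∃ q ∈ S, q ∈ T ∧ q ∉ U := by
  have h1 := Finset.card_union_add_card_inter S T
  have h2 : (S ∪ T).card ≤ n := by simpa using Finset.card_le_univ (S ∪ T)
  obtain ⟨q, hq, hqU⟩ := Finset.exists_mem_notMem_of_card_lt_card
    (s := U) (t := S ∩ T) (by omega)
  exact ⟨q, (Finset.mem_inter.1 hq).1, (Finset.mem_inter.1 hq).2, hqU⟩

/-! ### Local invariants -/

/-- The variables of a process have been assigned as the algorithm prescribes; `P` and `Q`
describe the possible senders and contents of the messages. -/
structure Coherent (quorum trim low high : ℕ) (P : Fin n → V → Prop) (Q : Fin n → Option V → Prop)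
    (s : State n V) : Prop where
  inputs_nodup : (s.inputs.map Prod.fst).Nodup
  inputs_prop : ∀ y ∈ s.inputs, P y.1 y.2
  branches_nodup : (s.branches.map Prod.fst).Nodup
  branches_prop : ∀ y ∈ s.branches, Q y.1 y.2
  branch : ∀ c, s.branch = some c →
    ∃ l, IsSample quorum P l ∧ c = chooseBranch trim (l.map Prod.snd)
  decision : ∀ d, s.decision = some d → ∃ c l, s.branch = some c ∧ IsSample quorum Q l ∧
    d = chooseVertex low high c (l.map Prod.snd)

/-- The algorithm never waits for a message that it has already received. -/
structure Prompt (quorum : ℕ) (s : State n V) : Prop where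
  branch : quorum ≤ s.inputs.length → s.branch ≠ none
  decision : s.branch ≠ none → quorum ≤ s.branches.length → s.decision ≠ none

theorem record_nodup {X : Type u} {l : List (Fin n × X)} (h : (l.map Prod.fst).Nodup)
    (q : Fin n) (x : X) : ((record l q x).map Prod.fst).Nodup := by
  unfold record
  split_ifs with hq
  · exact h
  · rw [List.map_append, List.nodup_append']
    refine ⟨h, by simp, ?_⟩
    intro r hr hr'
    simp only [List.map_cons, List.map_nil, List.mem_singleton] at hr'
    exact hq (hr' ▸ hr)

theorem record_prop {X : Type u} {l : List (Fin n × X)} {P : Fin n → X → Prop}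
    (h : ∀ y ∈ l, P y.1 y.2) {q : Fin n} {x : X} (hx : P q x) : ∀ y ∈ record l q x, P y.1 y.2 := by
  unfold record
  split_ifs
  · exact h
  · intro y hy
    rcases List.mem_append.1 hy with hy | hy
    · exact h y hy
    · rw [List.mem_singleton.1 hy]
      exact hx

theorem mem_record {X : Type u} (l : List (Fin n × X)) (q : Fin n) (x : X) :
    q ∈ (record l q x).map Prod.fst := by
  unfold record
  split_ifs with h
  · exact h
  · simp

theorem subset_record {X : Type u} {l : List (Fin n × X)} {q r : Fin n} {x : X}
    (h : r ∈ l.map Prod.fst) : r ∈ (record l q x).map Prod.fst := by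
  unfold record
  split_ifs
  · exact h
  · rw [List.map_append]
    exact List.mem_append_left _ h

theorem isSample_take {X : Type u} {l : List (Fin n × X)} {P : Fin n → X → Prop} {m : ℕ}
    (h1 : (l.map Prod.fst).Nodup) (h2 : ∀ y ∈ l, P y.1 y.2) (h3 : m ≤ l.length) :
    IsSample m P (l.take m) where
  length := by simpa using h3
  nodup := h1.sublist (List.Sublist.map _ (List.take_sublist _ _))
  prop y hy := h2 y (List.mem_of_mem_take hy)

section Steps

variable {quorum trim low high : ℕ} {s : State n V}

theorem endRoundOne_fields (s : State n V) :
    (endRoundOne quorum trim s).1.input = s.input ∧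
      (endRoundOne quorum trim s).1.inputs = s.inputs ∧
      (endRoundOne quorum trim s).1.branches = s.branches ∧
      (endRoundOne quorum trim s).1.decision = s.decision := by
  unfold endRoundOne
  split_ifs <;> exact ⟨rfl, rfl, rfl, rfl⟩

theorem endRoundTwo_fields (s : State n V) :
    (endRoundTwo quorum low high s).input = s.input ∧
      (endRoundTwo quorum low high s).inputs = s.inputs ∧
      (endRoundTwo quorum low high s).branches = s.branches ∧
      (endRoundTwo quorum low high s).branch = s.branch := by
  unfold endRoundTwo
  split
  · dsimp only
    split_ifs <;> simp_all
  · exact ⟨rfl, rfl, rfl, rfl⟩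

theorem endRoundOne_sent {p : Fin n} {m : Msg V}
    (h : m ∈ (endRoundOne quorum trim s).2 p) :
    ∃ c, m = .branch c ∧ (endRoundOne quorum trim s).1.branch = some c := by
  unfold endRoundOne at h ⊢
  split_ifs at h ⊢ with hs
  · exact ⟨_, Finset.mem_singleton.1 h, rfl⟩
  · simp at h

theorem endRoundOne_branch (h : s.branch = none) {c : Option V}
    (hc : (endRoundOne quorum trim s).1.branch = some c) (p : Fin n) :
    .branch c ∈ (endRoundOne quorum trim s).2 p := by
  unfold endRoundOne at hc ⊢
  split_ifs at hc ⊢ with hs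
  · rw [← Option.some.inj hc]
    exact Finset.mem_singleton_self _
  · rw [h] at hc
    cases hc

theorem endRoundOne_branch_of_some {c : Option V} (h : s.branch = some c) :
    (endRoundOne quorum trim s).1.branch = some c := by
  unfold endRoundOne
  rw [if_neg (by simp [h])]
  exact h

/-- Both waiting conditions are tested in turn after each receipt, so a process whose branch
messages came early decides in the step that assigns its branch. -/
theorem prompt_step (s : State n V) :
    Prompt quorum (endRoundTwo quorum low high (endRoundOne quorum trim s).1) := by
  obtain ⟨-, h1, h2, -⟩ :=
    endRoundTwo_fields (quorum := quorum) (low := low) (high := high) (endRoundOne quorum trim s).1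
  obtain ⟨-, h3, h4, -⟩ := endRoundOne_fields (quorum := quorum) (trim := trim) s
  constructor
  · rw [(endRoundTwo_fields _).2.2.2, h1, h3]
    intro hl
    unfold endRoundOne
    split_ifs with h
    · simp
    · exact fun hb => h ⟨hb, hl⟩
  · rw [(endRoundTwo_fields _).2.2.2, h2, h4, ← h4]
    generalize (endRoundOne quorum trim s).1 = t
    intro hb hl
    unfold endRoundTwo
    split
    · rw [if_pos hl]
      simp
    · rename_i hne
      obtain ⟨c, hc⟩ := Option.ne_none_iff_exists'.1 hb
      exact fun hd => hne c hc hd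

variable {P : Fin n → V → Prop} {Q : Fin n → Option V → Prop}

theorem Coherent.store (h : Coherent quorum trim low high P Q s) {q : Fin n} {m : Msg V}
    (hP : ∀ x, m = .input x → P q x) (hQ : ∀ c, m = .branch c → Q q c) :
    Coherent quorum trim low high P Q (store s q m) := by
  cases m with
  | input x =>
    exact { h with
      inputs_nodup := record_nodup h.inputs_nodup _ _
      inputs_prop := record_prop h.inputs_prop (hP x rfl) }
  | branch c =>
    exact { h with
      branches_nodup := record_nodup h.branches_nodup _ _
      branches_prop := record_prop h.branches_prop (hQ c rfl) }

theorem Coherent.endRoundOne (h : Coherent quorum trim low high P Q s) :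
    Coherent quorum trim low high P Q (endRoundOne quorum trim s).1 := by
  unfold TwoRound.endRoundOne
  split_ifs with hs
  · exact { h with
      branch := fun c hc => by
        cases hc
        exact ⟨_, isSample_take h.inputs_nodup h.inputs_prop hs.2, rfl⟩
      decision := fun d hd => by
        obtain ⟨c, l, hc, -⟩ := h.decision d hd
        rw [hs.1] at hc
        cases hc }
  · exact h

theorem Coherent.endRoundTwo (h : Coherent quorum trim low high P Q s) :
    Coherent quorum trim low high P Q (endRoundTwo quorum low high s) := by
  unfold TwoRound.endRoundTwo
  split
  · rename_i c hc hd
    split_ifs with hs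
    · exact { h with
        decision := fun d hd => by
          cases hd
          exact ⟨c, _, hc, isSample_take h.branches_nodup h.branches_prop hs, rfl⟩ }
    · exact h
  · exact h

end Steps

end TwoRound

namespace TwoRound

variable {n : ℕ} {V : Type u} [LinearOrder V]

/-! ### Executions of the two-round algorithms -/

section Execution

variable {quorum trim low high : ℕ} {mode : FailureMode} {f : ℕ}
  (E : (algorithm n V quorum trim low high).Execution mode f)

/-- The local state of `p` before the `k`-th event. -/
abbrev localState (k : ℕ) (p : Fin n) : State n V := E.state k p

theorem localState_wake {k : ℕ} {p : Fin n} (hp : E.Bound p) (h : E.event k = some (.wake p)) :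
    localState E (k + 1) p = localState E k p ∧
      E.sent k = fun _ => {Msg.input (localState E k p).input} := by
  have := E.step_honest k _ h hp
  exact ⟨congrArg Prod.fst this, congrArg Prod.snd this⟩

theorem localState_recv {k j : ℕ} {p q : Fin n} {m : Msg V} (hp : E.Bound p)
    (h : E.event k = some (.recv p q j m)) :
    localState E (k + 1) p = endRoundTwo quorum low high
        (endRoundOne quorum trim (store (localState E k p) q m)).1 ∧
      E.sent k = (endRoundOne quorum trim (store (localState E k p) q m)).2 := by
  have := E.step_honest k _ h hp
  exact ⟨congrArg Prod.fst this, congrArg Prod.snd this⟩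

/-- A wakeup sends the input but leaves the local state unchanged, so an invariant has to be checked
for receipts only. -/
theorem localState_induction {p : Fin n} (hp : E.Bound p) {C : State n V → Prop} {i k : ℕ}
    (hik : i ≤ k) (h0 : C (localState E i p))
    (hstep : ∀ k q j m, E.event k = some (.recv p q j m) → C (localState E k p) →
      C (endRoundTwo quorum low high
        (endRoundOne quorum trim (store (localState E k p) q m)).1)) :
    C (localState E k p) := by
  induction k, hik using Nat.le_induction with
  | base => exact h0
  | succ k _ ih =>
    cases he : E.event k with
    | none =>
      rw [localState, (E.step_none k he).1]
      exact ih
    | some e =>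
      by_cases hpe : p = e.proc
      · cases e with
        | wake q =>
          subst hpe
          rw [(localState_wake E hp he).1]
          exact ih
        | recv q r j m =>
          subst hpe
          rw [(localState_recv E hp he).1]
          exact hstep k r j m he ih
      · rw [localState, E.step_other k e he p hpe]
        exact ih

theorem localState_input {p : Fin n} (hp : E.Bound p) (k : ℕ) :
    (localState E k p).input = E.input p := by
  refine localState_induction E hp (C := fun s => s.input = E.input p) (Nat.zero_le k) ?_ ?_
  · rw [localState, E.state_zero]
    rfl
  · intro k q j m _ h
    rw [(endRoundTwo_fields _).1, (endRoundOne_fields _).1]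
    exact (store_fields _ _ _).1.trans h

theorem localState_branch_mono {p : Fin n} (hp : E.Bound p) {i k : ℕ} (hik : i ≤ k)
    {c : Option V} (h : (localState E i p).branch = some c) :
    (localState E k p).branch = some c := by
  refine localState_induction E hp (C := fun s => s.branch = some c) hik h ?_
  intro k q j m _ h
  rw [(endRoundTwo_fields _).2.2.2]
  exact endRoundOne_branch_of_some ((store_fields _ _ _).2.1.trans h)

/-- Process `p` assigns `c` to its variable `branch`. -/
def HasBranch (p : Fin n) (c : Option V) : Prop :=
  ∃ k, (localState E k p).branch = some c

theorem HasBranch.unique {p : Fin n} (hp : E.Bound p) {c c' : Option V} (h : HasBranch E p c)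
    (h' : HasBranch E p c') : c = c' := by
  obtain ⟨k, hk⟩ := h
  obtain ⟨k', hk'⟩ := h'
  have h1 := localState_branch_mono E hp (le_max_left k k') hk
  have h2 := localState_branch_mono E hp (le_max_right k k') hk'
  rw [h1] at h2
  exact Option.some.inj h2

theorem sent_cases {j : ℕ} {e : Event n (Msg V)} {r : Fin n} {m : Msg V}
    (he : E.event j = some e) (hq : E.Bound e.proc) (hm : m ∈ E.sent j r) :
    m = .input (E.input e.proc) ∨ ∃ c, m = .branch c ∧ HasBranch E e.proc c := by
  cases e with
  | wake q =>
    rw [(localState_wake E hq he).2, localState_input E hq] at hm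
    exact Or.inl (Finset.mem_singleton.1 hm)
  | recv q q' i m' =>
    rw [(localState_recv E hq he).2] at hm
    obtain ⟨c, rfl, hc⟩ := endRoundOne_sent hm
    refine Or.inr ⟨c, rfl, j + 1, ?_⟩
    rw [(localState_recv E hq he).1, (endRoundTwo_fields _).2.2.2]
    exact hc

/-- What is known about a received value is conditional on its sender being bound, since any other
sender may have sent anything. -/
theorem coherent {p : Fin n} (hp : E.Bound p) (k : ℕ) :
    Coherent quorum trim low high (fun q x => E.Bound q → x = E.input q)
      (fun q c => E.Bound q → HasBranch E q c) (localState E k p) := by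
  refine localState_induction E hp (C := Coherent quorum trim low high _ _) (Nat.zero_le k) ?_ ?_
  · rw [localState, E.state_zero]
    constructor <;> simp [algorithm]
  · intro k q j m he h
    obtain ⟨-, ⟨e, hej, rfl⟩, hm⟩ := E.recv_sent k p q j m he
    refine (h.store ?_ ?_).endRoundOne.endRoundTwo
    · rintro x rfl hq
      rcases sent_cases E hej hq hm with h | ⟨c, h, -⟩ <;> cases h
      rfl
    · rintro c rfl hq
      rcases sent_cases E hej hq hm with h | ⟨c, h, hc⟩ <;> cases h
      exact hc

theorem prompt (hquorum : 0 < quorum) {p : Fin n} (hp : E.Bound p) (k : ℕ) :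
    Prompt quorum (localState E k p) := by
  refine localState_induction E hp (C := Prompt quorum) (Nat.zero_le k) ?_ ?_
  · rw [localState, E.state_zero]
    constructor
    · intro h
      exact absurd (h.trans_eq (List.length_nil (α := Fin n × V))) (by omega)
    · intro h
      exact absurd rfl h
  · intro k q j m _ _
    exact prompt_step _

/-! ### Progress -/

theorem mem_inputs_of_recv {p : Fin n} (hp : E.Bound p) {i k j : ℕ} (hik : i < k) {q : Fin n}
    {x : V} (h : E.event i = some (.recv p q j (.input x))) :
    q ∈ (localState E k p).inputs.map Prod.fst := by
  refine localState_induction E hp (C := fun s => q ∈ s.inputs.map Prod.fst) hik ?_ ?_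
  · rw [Nat.succ_eq_add_one, (localState_recv E hp h).1, (endRoundTwo_fields _).2.1,
      (endRoundOne_fields _).2.1]
    exact mem_record _ _ _
  · intro k r j m _ h
    rw [(endRoundTwo_fields _).2.1, (endRoundOne_fields _).2.1]
    cases m with
    | input y => exact subset_record h
    | branch c => exact h

theorem mem_branches_of_recv {p : Fin n} (hp : E.Bound p) {i k j : ℕ} (hik : i < k) {q : Fin n}
    {c : Option V} (h : E.event i = some (.recv p q j (.branch c))) :
    q ∈ (localState E k p).branches.map Prod.fst := by
  refine localState_induction E hp (C := fun s => q ∈ s.branches.map Prod.fst) hik ?_ ?_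
  · rw [Nat.succ_eq_add_one, (localState_recv E hp h).1, (endRoundTwo_fields _).2.2.1,
      (endRoundOne_fields _).2.2.1]
    exact mem_record _ _ _
  · intro k r j m _ h
    rw [(endRoundTwo_fields _).2.2.1, (endRoundOne_fields _).2.2.1]
    cases m with
    | input y => exact h
    | branch c => exact subset_record h

theorem le_length_of_correct {X : Type u} {l : List (Fin n × X)} (hq : quorum ≤ n - f)
    (h : ∀ q, q ∉ E.faulty → q ∈ l.map Prod.fst) : quorum ≤ l.length := by
  classical
  have h1 : E.faultyᶜ ⊆ (l.map Prod.fst).toFinset := fun q hq => by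
    rw [List.mem_toFinset]
    exact h q (Finset.mem_compl.1 hq)
  have h2 := (Finset.card_le_card h1).trans (List.toFinset_card_le _)
  rw [Finset.card_compl, Fintype.card_fin, List.length_map] at h2
  have := E.card_faulty
  omega

theorem exists_sent_branch {p : Fin n} (hp : E.Bound p) {k : ℕ}
    (h : (localState E k p).branch ≠ none) :
    ∃ j < k, ∃ e c, E.event j = some e ∧ e.proc = p ∧ ∀ q, Msg.branch c ∈ E.sent j q := by
  induction k with
  | zero =>
    rw [localState, E.state_zero] at h
    exact absurd rfl h
  | succ k ih =>
    by_cases hk : (localState E k p).branch = none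
    · cases he : E.event k with
      | none =>
        rw [localState, (E.step_none k he).1] at h
        exact absurd hk h
      | some e =>
        by_cases hpe : p = e.proc
        · cases e with
          | wake q =>
            subst hpe
            rw [(localState_wake E hp he).1] at h
            exact absurd hk h
          | recv q r j m =>
            subst hpe
            rw [(localState_recv E hp he).1, (endRoundTwo_fields _).2.2.2] at h
            obtain ⟨c, hc⟩ := Option.ne_none_iff_exists'.1 h
            refine ⟨k, by omega, _, c, he, rfl, fun q => ?_⟩
            rw [(localState_recv E hp he).2]
            exact endRoundOne_branch ((store_fields _ _ _).2.1.trans hk) hc q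
        · rw [localState, E.step_other k e he p hpe] at h
          exact absurd hk h
    · obtain ⟨j, hj, hj'⟩ := ih hk
      exact ⟨j, by omega, hj'⟩

/-- If the correct processes have received the messages sent on wakeup before event `k` and those
sent before event `k` before event `k'`, then they have decided before event `k'`. -/
theorem allDecided_of_received (hquorum : 0 < quorum) (hq : quorum ≤ n - f) {k k' : ℕ}
    (hkk : k ≤ k')
    (h1 : ∀ j p q m, p ∉ E.faulty → q ∉ E.faulty → E.event j = some (.wake q) → m ∈ E.sent j p →
      ∃ i < k, E.event i = some (.recv p q j m))
    (h2 : ∀ j < k, ∀ e p m, E.event j = some e → p ∉ E.faulty → e.proc ∉ E.faulty →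
      m ∈ E.sent j p → ∃ i < k', E.event i = some (.recv p e.proc j m)) :
    E.AllDecided k' := by
  have hbranch : ∀ p, p ∉ E.faulty → (localState E k p).branch ≠ none := by
    intro p hp
    refine (prompt E hquorum (Or.inr hp) k).branch (le_length_of_correct E hq fun q hq => ?_)
    obtain ⟨j, hj, -⟩ := E.wake_correct q hq
    obtain ⟨i, hi, hi'⟩ := h1 j p q (.input (localState E j q).input) hp hq hj (by
      rw [(localState_wake E (Or.inr hq) hj).2]
      exact Finset.mem_singleton_self _)
    exact mem_inputs_of_recv E (Or.inr hp) hi hi'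
  intro p hp
  refine Option.ne_none_iff_exists'.1
    ((prompt E hquorum (Or.inr hp) k').decision ?_ (le_length_of_correct E hq fun q hq => ?_))
  · obtain ⟨c, hc⟩ := Option.ne_none_iff_exists'.1 (hbranch p hp)
    rw [localState_branch_mono E (Or.inr hp) hkk hc]
    simp
  · obtain ⟨j, hj, e, c, he, rfl, hm⟩ := exists_sent_branch E (Or.inr hq) (hbranch q hq)
    obtain ⟨i, hi, hi'⟩ := h2 j hj e p _ he hp hq (hm p)
    exact mem_branches_of_recv E (Or.inr hp) hi hi'

end Execution

end TwoRound

namespace Algorithm.Execution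

variable {n : ℕ} {V : Type u} {D : Type v} {A : Algorithm.{u, v, w} n V D} {mode : FailureMode}
  {f : ℕ} (E : A.Execution mode f)

theorem exists_recv {j : ℕ} {e : Event n A.Msg} {p : Fin n} {m : A.Msg} (he : E.event j = some e)
    (hp : p ∉ E.faulty) (hm : m ∈ E.sent j p) : ∃ i, E.event i = some (.recv p e.proc j m) := by
  obtain ⟨i, q, hi⟩ := E.recv_eventually j p m hp hm
  obtain ⟨-, ⟨e', he', rfl⟩, -⟩ := E.recv_sent i p q j m hi
  rw [he] at he'
  cases he'
  exact ⟨i, hi⟩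

/-- The messages sent to correct processes before the `J`-th event have all been received at some
point. -/
theorem exists_all_received (J : ℕ) : ∃ K, ∀ j < J, ∀ e p m, E.event j = some e → p ∉ E.faulty →
    m ∈ E.sent j p → ∃ i < K, E.event i = some (.recv p e.proc j m) := by
  classical
  have : ∀ (j : ℕ) (p : Fin n) (m : A.Msg), ∃ i, ∀ e, E.event j = some e → p ∉ E.faulty →
      m ∈ E.sent j p → E.event i = some (.recv p e.proc j m) := by
    intro j p m
    by_cases h : ∃ e, E.event j = some e ∧ p ∉ E.faulty ∧ m ∈ E.sent j p
    · obtain ⟨e, he, hp, hm⟩ := h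
      obtain ⟨i, hi⟩ := E.exists_recv he hp hm
      refine ⟨i, fun e' he' _ _ => ?_⟩
      rw [he] at he'
      cases he'
      exact hi
    · exact ⟨0, fun e he hp hm => absurd ⟨e, he, hp, hm⟩ h⟩
  choose i hi using this
  refine ⟨(Finset.range J).sup (fun j => Finset.univ.sup fun p => (E.sent j p).sup (i j p)) + 1,
    fun j hj e p m he hp hm => ⟨i j p m, ?_, hi j p m e he hp hm⟩⟩
  rw [Nat.lt_add_one_iff]
  calc i j p m ≤ (E.sent j p).sup (i j p) := Finset.le_sup hm
    _ ≤ Finset.univ.sup fun p => (E.sent j p).sup (i j p) :=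
      Finset.le_sup (f := fun p => (E.sent j p).sup (i j p)) (Finset.mem_univ p)
    _ ≤ _ := Finset.le_sup (f := fun j => Finset.univ.sup fun p => (E.sent j p).sup (i j p))
      (Finset.mem_range.2 hj)

theorem exists_all_awake : ∃ J, ∀ j q, q ∉ E.faulty → E.event j = some (.wake q) → j < J := by
  have : ∀ q, ∃ j, ∀ i, q ∉ E.faulty → E.event i = some (.wake q) → i = j := by
    intro q
    by_cases hq : q ∈ E.faulty
    · exact ⟨0, fun _ h => absurd hq h⟩
    · obtain ⟨j, -, hj⟩ := E.wake_correct q hq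
      exact ⟨j, fun i _ hi => hj i hi⟩
  choose j hj using this
  refine ⟨Finset.univ.sup j + 1, fun i q hq hi => ?_⟩
  rw [hj q i hq hi, Nat.lt_add_one_iff]
  exact Finset.le_sup (Finset.mem_univ q)

end Algorithm.Execution

/-! ### Termination and the time bound 2 -/

namespace TwoRound

variable {n : ℕ} {V : Type u} [LinearOrder V] {quorum trim low high : ℕ} {mode : FailureMode}
  {f : ℕ}

theorem termination (hquorum : 0 < quorum) (hq : quorum ≤ n - f)
    (E : (algorithm n V quorum trim low high).Execution mode f) {p : Fin n} (hp : p ∉ E.faulty) :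
    ∃ d, E.Decides p d := by
  obtain ⟨J, hJ⟩ := E.exists_all_awake
  obtain ⟨k, hk⟩ := E.exists_all_received J
  obtain ⟨k', hk'⟩ := E.exists_all_received k
  obtain ⟨d, hd⟩ := allDecided_of_received E hquorum hq (le_max_left k k')
    (fun j p q m hp hq hj hm => hk j (hJ j q hq hj) _ p m hj hp hm)
    (fun j hj e p m he hp _ hm => by
      obtain ⟨i, hi, hi'⟩ := hk' j hj e p m he hp hm
      exact ⟨i, lt_max_of_lt_right hi, hi'⟩) p hp
  exact ⟨d, _, hd⟩

theorem timeComplexity_le (hquorum : 0 < quorum) (hq : quorum ≤ n - f) :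
    (algorithm n V quorum trim low high).timeComplexity mode f ≤ 2 := by
  refine sSup_le ?_
  rintro _ ⟨E, time, N, δ, htime, hleast, hδ, hpos, rfl⟩
  rw [ENNReal.div_le_iff (by exact_mod_cast hpos.ne') (by simp)]
  suffices time N ≤ 2 * δ by exact_mod_cast this
  by_contra hlt
  push Not at hlt
  have hN : ∀ {i}, time i ≤ 2 * δ → i < N := fun {i} hi => by
    by_contra h
    exact absurd (htime.mono (not_lt.1 h)) (by omega)
  have hdelay : ∀ {k p q j m}, E.event k = some (.recv p q j m) → p ∉ E.faulty → q ∉ E.faulty →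
      time j ≤ 2 * δ → time k ≤ time j + δ := by
    intro k p q j m hk hp hq hj
    have := hδ.2 ⟨k, p, q, j, m, hk, hp, hq, (hN hj).le, rfl⟩
    omega
  -- The first event after time `δ` separates the rounds: before it all wakeup messages have
  -- arrived, and what was sent before it arrives by time `2 * δ`, hence before event `N`.
  have hex : ∃ k, δ < time k := ⟨N, by omega⟩
  classical
  have hfind : ∀ {i}, time i ≤ δ → i < Nat.find hex := fun {i} hi => by
    by_contra h
    have := htime.mono (not_lt.1 h)
    have := Nat.find_spec hex
    omega
  have hall := allDecided_of_received E hquorum hq (k := Nat.find hex) (k' := N)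
    (Nat.find_min' hex (by omega)) ?_ ?_
  · have := hleast.2 hall
    omega
  · intro j p q m hp hq hj hm
    obtain ⟨i, hi⟩ := E.exists_recv hj hp hm
    have h0 : time j = 0 := htime.wake_zero j q hj fun i hij hi => by
      have := (E.wake_correct q hq).unique hi hj
      omega
    have := hdelay hi hp hq (by omega)
    exact ⟨i, hfind (by omega), hi⟩
  · intro j hj e p m he hp hq hm
    obtain ⟨i, hi⟩ := E.exists_recv he hp hm
    have h0 : time j ≤ δ := not_lt.1 (Nat.find_min hex hj)
    have := hdelay hi hp hq (by omega)
    exact ⟨i, hN (by omega), hi⟩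

end TwoRound

/-! ### Agreement and validity by counting senders -/

namespace TwoRound

variable {n : ℕ} {V : Type u} [LinearOrder V]

section Safety

variable {f b : ℕ} {mode : FailureMode}
  (E : (algorithm n V (n - f) b (b + 1) (n - f - b)).Execution mode f)

/-- The inputs in a sample, as they are known to the process that received them. -/
abbrev InputSample (l : List (Fin n × V)) : Prop :=
  IsSample (n - f) (fun q x => E.Bound q → x = E.input q) l

/-- The branches in a sample, as they are known to the process that received them. -/
abbrev BranchSample (l : List (Fin n × Option V)) : Prop :=
  IsSample (n - f) (fun q c => E.Bound q → HasBranch E q c) l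

variable {E}

theorem HasBranch.exists_sample {p : Fin n} (hp : E.Bound p) {c : Option V}
    (h : HasBranch E p c) : ∃ l, InputSample E l ∧ c = chooseBranch b (l.map Prod.snd) := by
  obtain ⟨k, hk⟩ := h
  exact (coherent E hp k).branch c hk

theorem exists_sample_of_decides {p : Fin n} (hp : E.Bound p) {d : SpiderVertex V 2}
    (h : E.Decides p d) : ∃ c l, HasBranch E p c ∧ BranchSample E l ∧
      d = chooseVertex (b + 1) (n - f - b) c (l.map Prod.snd) := by
  obtain ⟨k, hk⟩ := h
  obtain ⟨c, l, hc, h⟩ := (coherent E hp k).decision d hk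
  exact ⟨c, l, ⟨k, hc⟩, h⟩

variable {U : Finset (Fin n)} (hn : 2 * f + 3 * b < n) (hU : U.card ≤ b)
  (hbound : ∀ q, q ∉ U → E.Bound q)

theorem card_senders_le {X : Type u} {m : ℕ} {P : Fin n → X → Prop} {l : List (Fin n × X)}
    (h : IsSample m P l) (φ : X → Bool) :
    (senders l φ).card + (l.map Prod.snd).countP (fun x => !φ x) = m := by
  rw [card_senders h.nodup, ← h.length, ← List.length_map (f := Prod.snd) (as := l),
    List.length_eq_countP_add_countP φ]
  simp

include hn hU hbound

/-- If `v < v'`, then `n - f - b` senders reported at most `v` to `p` and as many reported at least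
`v'` to `p'`. As `2 * (n - f - b) > n + b`, a bound process did both. -/
theorem branch_le {p p' : Fin n} (hp : E.Bound p) (hp' : E.Bound p') {v v' : V}
    (h : HasBranch E p (some v)) (h' : HasBranch E p' (some v')) : v' ≤ v := by
  by_contra hlt
  push Not at hlt
  obtain ⟨l, hl, hc⟩ := h.exists_sample hp
  obtain ⟨l', hl', hc'⟩ := h'.exists_sample hp'
  have h1 := (countP_of_chooseBranch (by simp [hl.length]; omega) hc.symm).1
  have h2 := (countP_of_chooseBranch (by simp [hl'.length]; omega) hc'.symm).2
  have c1 := card_senders_le hl (fun x => !decide (v < x))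
  have c2 := card_senders_le hl' (fun x => !decide (x < v'))
  simp only [Bool.not_not] at c1 c2
  obtain ⟨q, hq, hq', hqU⟩ := exists_mem_inter hU
    (S := senders l fun x => !decide (v < x)) (T := senders l' fun x => !decide (x < v')) (by omega)
  obtain ⟨x, hx, hxv⟩ := mem_senders.1 hq
  obtain ⟨y, hy, hyv⟩ := mem_senders.1 hq'
  have e1 := hl.prop _ hx (hbound q hqU)
  have e2 := hl'.prop _ hy (hbound q hqU)
  simp only [Bool.not_eq_true', decide_eq_false_iff_not, not_lt] at hxv hyv e1 e2
  subst e1 e2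
  exact absurd (hyv.trans hxv) (not_le.2 hlt)

theorem branch_unique {p p' : Fin n} (hp : E.Bound p) (hp' : E.Bound p') {v v' : V}
    (h : HasBranch E p (some v)) (h' : HasBranch E p' (some v')) : v = v' :=
  le_antisymm (branch_le hn hU hbound hp' hp h' h) (branch_le hn hU hbound hp hp' h h')

/-- Among `n - f` senders, at least `n - f - b` reported at most `v` and as many at least `v`. The
overlap of size `n - f - 2 * b > b` contains a bound process, whose input is exactly `v`. -/
theorem exists_input_of_branch {p : Fin n} (hp : E.Bound p) {v : V}
    (h : HasBranch E p (some v)) : ∃ q, E.Bound q ∧ E.input q = v := by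
  obtain ⟨l, hl, hc⟩ := h.exists_sample hp
  obtain ⟨h1, h2⟩ := countP_of_chooseBranch (by simp [hl.length]; omega) hc.symm
  have c1 := card_senders_le hl (fun x => !decide (v < x))
  have c2 := card_senders_le hl (fun x => !decide (x < v))
  simp only [Bool.not_not] at c1 c2
  have c3 := Finset.card_union_add_card_inter (senders l fun x => !decide (v < x))
    (senders l fun x => !decide (x < v))
  have c4 : (senders l (fun x => !decide (v < x)) ∪ senders l fun x => !decide (x < v)).card ≤
      n - f := by
    rw [← hl.length, ← card_senders_true hl.nodup]
    refine Finset.card_le_card fun q hq => mem_senders.2 ?_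
    rcases Finset.mem_union.1 hq with hq | hq <;> obtain ⟨x, hx, -⟩ := mem_senders.1 hq <;>
      exact ⟨x, hx, rfl⟩
  obtain ⟨q, hq, hqU⟩ := Finset.exists_mem_notMem_of_card_lt_card (s := U)
    (t := senders l (fun x => !decide (v < x)) ∩ senders l fun x => !decide (x < v)) (by omega)
  obtain ⟨x, hx, hxv⟩ := mem_senders.1 (Finset.mem_inter.1 hq).1
  obtain ⟨y, hy, hyv⟩ := mem_senders.1 (Finset.mem_inter.1 hq).2
  have e1 := hl.prop _ hx (hbound q hqU)
  have e2 := hl.prop _ hy (hbound q hqU)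
  simp only [Bool.not_eq_true', decide_eq_false_iff_not, not_lt] at hxv hyv e1 e2
  subst e1 e2
  exact ⟨q, hbound q hqU, le_antisymm hxv hyv⟩

omit hn in
theorem countP_le_of_bound {X : Type u} {m : ℕ} {P : Fin n → X → Prop} {l : List (Fin n × X)}
    (h : IsSample m (fun q x => E.Bound q → P q x) l) (φ : X → Bool)
    (hφ : ∀ q x, E.Bound q → P q x → φ x = false) : (l.map Prod.snd).countP φ ≤ b := by
  rw [← card_senders h.nodup]
  refine (Finset.card_le_card fun q hq => ?_).trans hU
  obtain ⟨x, hx, hxφ⟩ := mem_senders.1 hq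
  by_contra hqU
  rw [hφ q x (hbound q hqU) (h.prop _ hx (hbound q hqU))] at hxφ
  cases hxφ

theorem branch_of_input {p : Fin n} (hp : E.Bound p) {v : V}
    (hv : ∀ q, E.Bound q → E.input q = v) {c : Option V} (h : HasBranch E p c) : c = some v := by
  obtain ⟨l, hl, rfl⟩ := h.exists_sample hp
  refine chooseBranch_of_countP (by simp [hl.length]; omega) ?_
  refine countP_le_of_bound hU hbound hl _ ?_
  rintro q x hq rfl
  simp [hv q hq]

omit hn in
theorem exists_branch_of_count {l : List (Fin n × Option V)} (hl : BranchSample E l) {v : V}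
    (h : b + 1 ≤ (l.map Prod.snd).count (some v)) :
    ∃ q, E.Bound q ∧ HasBranch E q (some v) := by
  rw [List.count, ← card_senders hl.nodup] at h
  obtain ⟨q, hq, hqU⟩ := Finset.exists_mem_notMem_of_card_lt_card (s := U)
    (t := senders l fun c => c == some v) (by omega)
  obtain ⟨x, hx, hxv⟩ := mem_senders.1 hq
  simp only [beq_iff_eq] at hxv
  subst hxv
  exact ⟨q, hbound q hqU, hl.prop _ hx (hbound q hqU)⟩

/-- Of the `n - f - b` senders of `v`, at least `n - 2 * f - b` also occur in the other sample, and
all but `b` of these are bound and repeat their branch. What remains exceeds `b`. -/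
theorem low_le_count {l l' : List (Fin n × Option V)} (hl : BranchSample E l)
    (hl' : BranchSample E l') {v : V} (h : n - f - b ≤ (l.map Prod.snd).count (some v)) :
    b + 1 ≤ (l'.map Prod.snd).count (some v) := by
  have hsub : (senders l (fun c => c == some v) ∩ senders l' fun _ => true) \ U ⊆
      senders l' fun c => c == some v := by
    intro q hq
    simp only [Finset.mem_sdiff, Finset.mem_inter] at hq
    obtain ⟨⟨hq, hq'⟩, hqU⟩ := hq
    obtain ⟨x, hx, hxv⟩ := mem_senders.1 hq
    obtain ⟨y, hy, -⟩ := mem_senders.1 hq'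
    refine mem_senders.2 ⟨y, hy, ?_⟩
    have hyx : y = x := HasBranch.unique E (hbound q hqU) (hl'.prop _ hy (hbound q hqU))
      (hl.prop _ hx (hbound q hqU))
    rw [hyx]
    exact hxv
  have h1 := Finset.card_le_card hsub
  have h2 := Finset.le_card_sdiff U (senders l (fun c => c == some v) ∩ senders l' fun _ => true)
  have h3 := Finset.card_union_add_card_inter (senders l (fun c => c == some v))
    (senders l' fun _ => true)
  have h4 : (senders l (fun c => c == some v) ∪ senders l' fun _ => true).card ≤ n := by
    simpa using Finset.card_le_univ (senders l (fun c => c == some v) ∪ senders l' fun _ => true)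
  rw [List.count, ← card_senders hl.nodup] at h
  rw [List.count, ← card_senders hl'.nodup]
  have h5 := card_senders_true hl'.nodup
  rw [hl'.length] at h5
  omega

/-- The possible decisions: `c` is the branch of the process, and `B` are the branches that it
received. -/
theorem decision_cases {p : Fin n} (hp : E.Bound p) {d : SpiderVertex V 2} (h : E.Decides p d) :
    ∃ c l, HasBranch E p c ∧ BranchSample E l ∧
      ((d = .center ∧ c = none ∧ ∀ v, (l.map Prod.snd).count (some v) < b + 1) ∨
      ∃ q v, E.Bound q ∧ HasBranch E q (some v) ∧
        ((d = .branch v 0 ∧ (c = none ∨ ∀ v, (l.map Prod.snd).count (some v) < n - f - b)) ∨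
          (d = .branch v 1 ∧ n - f - b ≤ (l.map Prod.snd).count (some v)))) := by
  obtain ⟨c, l, hc, hl, rfl⟩ := exists_sample_of_decides hp h
  refine ⟨c, l, hc, hl, ?_⟩
  cases c with
  | none =>
    rcases chooseVertex_none (low := b + 1) (high := n - f - b) (by omega) (l.map Prod.snd) with
      ⟨v, hv, hd⟩ | ⟨hd, hv⟩
    · obtain ⟨q, hq, hq'⟩ := exists_branch_of_count hU hbound hl hv
      exact Or.inr ⟨q, v, hq, hq', Or.inl ⟨hd, Or.inl rfl⟩⟩
    · exact Or.inl ⟨hd, rfl, hv⟩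
  | some w =>
    rcases chooseVertex_some (low := b + 1) (high := n - f - b) (by omega) w (l.map Prod.snd) with
      ⟨v, hv, hd⟩ | ⟨hd, hv⟩
    · obtain ⟨q, hq, hq'⟩ := exists_branch_of_count hU hbound hl (v := v) (by omega)
      exact Or.inr ⟨q, v, hq, hq', Or.inr ⟨hd, hv⟩⟩
    · exact Or.inr ⟨p, w, hp, hc, Or.inl ⟨hd, Or.inr hv⟩⟩

/-- By `branch_unique` both decisions lie on one path from the center to a leaf. The only pair at
distance 2, center and leaf, is excluded by `low_le_count`. -/
theorem agreement {p p' : Fin n} {d d' : SpiderVertex V 2} (hp : E.Bound p) (hp' : E.Bound p')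
    (h : E.Decides p d) (h' : E.Decides p' d') : (spiderGraph V 2).edist d d' ≤ 1 := by
  rw [SimpleGraph.edist_le_one_iff_adj_or_eq, spiderGraph_adj]
  obtain ⟨c, l, -, hl, hd⟩ := decision_cases hn hU hbound hp h
  obtain ⟨c', l', -, hl', hd'⟩ := decision_cases hn hU hbound hp' h'
  rcases hd with ⟨rfl, -, hlow⟩ | ⟨q, v, hq, hv, hd⟩ <;>
    rcases hd' with ⟨rfl, -, hlow'⟩ | ⟨q', v', hq', hv', hd'⟩
  · exact Or.inr rfl
  · rcases hd' with ⟨rfl, -⟩ | ⟨rfl, hhigh⟩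
    · exact Or.inl ⟨v', Or.inl rfl⟩
    · exact absurd (low_le_count hn hU hbound hl' hl hhigh) (not_le.2 (hlow v'))
  · rcases hd with ⟨rfl, -⟩ | ⟨rfl, hhigh⟩
    · exact Or.inl ⟨v, Or.inl Sym2.eq_swap⟩
    · exact absurd (low_le_count hn hU hbound hl hl' hhigh) (not_le.2 (hlow' v))
  · obtain rfl := branch_unique hn hU hbound hq hq' hv hv'
    rcases hd with ⟨rfl, -⟩ | ⟨rfl, -⟩ <;> rcases hd' with ⟨rfl, -⟩ | ⟨rfl, -⟩
    · exact Or.inr rfl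
    · exact Or.inl ⟨v, Or.inr rfl⟩
    · exact Or.inl ⟨v, Or.inr Sym2.eq_swap⟩
    · exact Or.inr rfl

/-- With unanimous inputs every bound branch is that input, the high threshold is met and the leaf
is decided. Otherwise the subtree contains the center and the whole path of every input. -/
theorem validity {p : Fin n} {d : SpiderVertex V 2} (hp : E.Bound p) (h : E.Decides p d) :
    d ∈ spiderSubtree 2 (E.input '' {q | E.Bound q}) := by
  obtain ⟨c, l, hc, hl, hd⟩ := decision_cases hn hU hbound hp h
  by_cases hall : ∀ q, E.Bound q → E.input q = E.input p
  · have hcp := branch_of_input hn hU hbound hp hall hc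
    have hcount : n - f - b ≤ (l.map Prod.snd).count (some (E.input p)) := by
      have h1 := countP_le_of_bound hU hbound hl (fun c => !(c == some (E.input p)))
        (fun q c hq hc => by simp [branch_of_input hn hU hbound hq hall hc])
      have h2 := card_senders_le hl (fun c => c == some (E.input p))
      rw [card_senders hl.nodup] at h2
      rw [List.count]
      omega
    rcases hd with ⟨-, h, -⟩ | ⟨q, v, hq, hv, ⟨-, h | h⟩ | ⟨rfl, -⟩⟩
    · rw [hcp] at h
      cases h
    · rw [hcp] at h
      cases h
    · exact absurd hcount (not_le.2 (h _))
    · obtain ⟨r, hr, rfl⟩ := exists_input_of_branch hn hU hbound hq hv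
      exact leaf_mem_spiderSubtree ⟨r, hr, rfl⟩
  · push Not at hall
    obtain ⟨q₀, hq₀, hne⟩ := hall
    have hmem : ∀ {q}, E.Bound q → E.input q ∈ E.input '' {q | E.Bound q} :=
      fun hq => ⟨_, hq, rfl⟩
    have hother : ∀ v, ∃ w ∈ E.input '' {q | E.Bound q}, v ≠ w := by
      intro v
      by_cases hv : v = E.input p
      · exact ⟨_, hmem hq₀, hv ▸ hne.symm⟩
      · exact ⟨_, hmem hp, hv⟩
    rcases hd with ⟨rfl, -⟩ | ⟨q, v, hq, hv, hd⟩
    · exact (inner_mem_spiderSubtree (hmem hq₀) (hmem hp) hne).2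
    · obtain ⟨r, hr, hrv⟩ := exists_input_of_branch hn hU hbound hq hv
      obtain ⟨w, hw, hvw⟩ := hother v
      have hv' : v ∈ E.input '' {q | E.Bound q} := ⟨r, hr, hrv⟩
      rcases hd with ⟨rfl, -⟩ | ⟨rfl, -⟩
      · exact (inner_mem_spiderSubtree hv' hw hvw).1
      · exact leaf_mem_spiderSubtree hv'

end Safety

theorem solvesConnectedConsensus {f b : ℕ} {mode : FailureMode} (hn : 2 * f + 3 * b < n)
    (hb : mode = .crash ∨ f ≤ b) :
    (algorithm n V (n - f) b (b + 1) (n - f - b)).SolvesConnectedConsensus mode f := by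
  have key : ∀ E : (algorithm n V (n - f) b (b + 1) (n - f - b)).Execution mode f,
      ∃ U : Finset (Fin n), U.card ≤ b ∧ ∀ q, q ∉ U → E.Bound q := by
    intro E
    rcases hb with rfl | hb
    · exact ⟨∅, by simp, fun q _ => Or.inl rfl⟩
    · exact ⟨E.faulty, E.card_faulty.trans hb, fun q hq => Or.inr hq⟩
  refine ⟨fun E p hp => termination (by omega) le_rfl E hp, ?_, ?_⟩
  · intro E p d hp hd
    obtain ⟨U, hU, hbound⟩ := key E
    exact validity hn hU hbound hp hd
  · intro E p q d d' hp hq hd hd'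
    obtain ⟨U, hU, hbound⟩ := key E
    exact agreement hn hU hbound hp hq hd hd'

end TwoRound

theorem two_rounds_crash {V : Type u} [Nontrivial V] {n f : ℕ} (h2 : 2 ≤ n) (hn : n ≤ 4 * f)
    (A : Algorithm.{u, u, w} n V (SpiderVertex V 2)) (hA : A.SolvesConnectedConsensus .crash f) :
    ¬ A.DecidesInOneRound .crash f ∧ 2 ≤ A.timeComplexity .crash f :=
  hA.two_rounds_of_views (Algorithm.not_forall_decision_view_crash h2 hn hA)

theorem two_rounds_malicious {V : Type u} [Nontrivial V] {n f : ℕ} (h2 : 2 ≤ n) (hn : n ≤ 9 * f)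
    (A : Algorithm.{u, u, w} n V (SpiderVertex V 2))
    (hA : A.SolvesConnectedConsensus .malicious f) :
    ¬ A.DecidesInOneRound .malicious f ∧ 2 ≤ A.timeComplexity .malicious f :=
  hA.two_rounds_of_views (Algorithm.not_forall_decision_view_malicious h2 hn hA)

theorem crashAlgorithm_solves {V : Type u} [LinearOrder V] {n f : ℕ} (hn : 2 * f < n) :
    (crashAlgorithm n f V).SolvesConnectedConsensus .crash f :=
  TwoRound.solvesConnectedConsensus (b := 0) (by omega) (Or.inl rfl)

theorem maliciousAlgorithm_solves {V : Type u} [LinearOrder V] {n f : ℕ} (hn : 5 * f < n) :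
    (maliciousAlgorithm n f V).SolvesConnectedConsensus .malicious f := by
  have := TwoRound.solvesConnectedConsensus (n := n) (V := V) (f := f) (b := f)
    (mode := .malicious) (by omega) (Or.inr le_rfl)
  rwa [show n - f - f = n - 2 * f by omega] at this

theorem mainTheorem6 {V : Type u} [Fintype V] [LinearOrder V] [Nontrivial V] (n f : ℕ) :
    (2 ≤ n → n ≤ 4 * f →
      ∀ A : Algorithm.{u, u, w} n V (SpiderVertex V 2), A.SolvesConnectedConsensus .crash f →
        ¬ A.DecidesInOneRound .crash f ∧ 2 ≤ A.timeComplexity .crash f) ∧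
    (2 ≤ n → n ≤ 9 * f →
      ∀ A : Algorithm.{u, u, w} n V (SpiderVertex V 2), A.SolvesConnectedConsensus .malicious f →
        ¬ A.DecidesInOneRound .malicious f ∧ 2 ≤ A.timeComplexity .malicious f) ∧
    (2 * f < n → n ≤ 4 * f →
      (crashAlgorithm n f V).SolvesConnectedConsensus .crash f ∧
      (crashAlgorithm n f V).timeComplexity .crash f = 2 ∧
      ∀ A : Algorithm.{u, u, w} n V (SpiderVertex V 2), A.SolvesConnectedConsensus .crash f →
        (crashAlgorithm n f V).timeComplexity .crash f ≤ A.timeComplexity .crash f) ∧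
    (5 * f < n → n ≤ 9 * f →
      (maliciousAlgorithm n f V).SolvesConnectedConsensus .malicious f ∧
      (maliciousAlgorithm n f V).timeComplexity .malicious f = 2 ∧
      ∀ A : Algorithm.{u, u, w} n V (SpiderVertex V 2), A.SolvesConnectedConsensus .malicious f →
        (maliciousAlgorithm n f V).timeComplexity .malicious f ≤
          A.timeComplexity .malicious f) := by
  refine ⟨two_rounds_crash, two_rounds_malicious, fun h h' => ?_, fun h h' => ?_⟩
  · have hsolves := crashAlgorithm_solves (V := V) h
    have htime : (crashAlgorithm n f V).timeComplexity .crash f = 2 :=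
      le_antisymm (TwoRound.timeComplexity_le (by omega) le_rfl)
        (two_rounds_crash (by omega) h' _ hsolves).2
    exact ⟨hsolves, htime, fun A hA => htime ▸ (two_rounds_crash (by omega) h' A hA).2⟩
  · have hsolves := maliciousAlgorithm_solves (V := V) h
    have htime : (maliciousAlgorithm n f V).timeComplexity .malicious f = 2 :=
      le_antisymm (TwoRound.timeComplexity_le (by omega) le_rfl)
        (two_rounds_malicious (by omega) h' _ hsolves).2
    exact ⟨hsolves, htime, fun A hA => htime ▸ (two_rounds_malicious (by omega) h' A hA).2⟩
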